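/- For $n\ge 2$ and $w\in\mathbb R$ let $A_n(w)$ be the adjacency matrix of the path on vertices $1,\dots,n$ with unit edge weights and with a loop of weight $w$ added at each of the two end vertices $1$ and $n$; that is, $A_n(w)$ is the $n\times n$ symmetric tridiagonal matrix with off-diagonal entries $1$ and diagonal $(w,0,\dots,0,w)$. Let $p_n(w,t)=\left|\left(e^{\,itA_n(w)}\right)_{1,n}\right|^2$ be the fidelity of state transfer between the end vertices at readout time $t\ge 0$. Then, for every fixed $w>1$, there are functions $f,g:\mathbb N\to\mathbb R$, depending only on $w$, with $f(n)=O(n^2)$ and $g(n)=O(1/n)$ as $n\to\infty$, such that for all $n\ge 2$ and all $t\ge 0$ the fidelity $p_n(\cdot,t)$ is differentiable at $w$ and $$\left|\frac{\partial p_n}{\partial w}(w,t)\right|\le \frac{8n^3}{3\pi^2}+f(n)+4t\left(\frac{w^4-2w^2+3}{2w^6}+g(n)\right).$$ In particular, the implied constants do not depend on $t$. -/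

import Mathlib

open Filter Asymptotics

/-- The (weighted) adjacency matrix of the path on the `n` vertices `0, 1, …, n - 1`, with unit
edge weights and a loop of weight `w` at each of the two end vertices. -/
noncomputable def loopedPathMatrix (n : ℕ) (w : ℝ) : Matrix (Fin n) (Fin n) ℝ :=
  Matrix.of fun i j =>
    if i = j then (if i.val = 0 ∨ i.val + 1 = n then w else 0)
    else if i.val + 1 = j.val ∨ j.val + 1 = i.val then 1 else 0

/-- The transition matrix `U(t) = exp (i t A)` of the Hamiltonian `A`. -/
noncomputable def transitionMatrix {n : ℕ} (A : Matrix (Fin n) (Fin n) ℝ) (t : ℝ) :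
    Matrix (Fin n) (Fin n) ℂ :=
  NormedSpace.exp ((Complex.I * (t : ℂ)) • A.map Complex.ofReal)

/-- The fidelity of state transfer from `a` to `b` at readout time `t`: `|U(t)_{a,b}|²`. -/
noncomputable def stateTransferFidelity {n : ℕ} (A : Matrix (Fin n) (Fin n) ℝ) (a b : Fin n)
    (t : ℝ) : ℝ :=
  ‖transitionMatrix A t a b‖ ^ 2

/-- The fidelity of state transfer between the two end vertices of the path on `n ≥ 1` vertices
with loops of weight `w` on the end vertices, at readout time `t`. -/
noncomputable def endFidelity (n : ℕ) (hn : 0 < n) (w t : ℝ) : ℝ :=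
  stateTransferFidelity (loopedPathMatrix n w) ⟨0, hn⟩ ⟨n - 1, Nat.sub_lt hn Nat.one_pos⟩ t

/-! Reflection of the path makes every eigenvector even or odd, so the end-to-end amplitude is `(S -
T) / 2`. Here `S` and `T` are Fourier transforms of two probability measures on the spectrum, one
per symmetry class. Duhamel's formula with the perturbation at the two end vertices gives its
derivative in `w` as `I * (S * S - T * T) / 2`, with convolutions over `[0, t]`.

For long paths each measure has one large atom: the state localized at the ends, with eigenvalue
near `w + 1 / w` and mass near `m = 1 - 1 / w ^ 2` (`exists_top`). The other eigenvalues in the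
class lie in `[-2, 2]`, have mass `O(1 / n)` (`sq_zero_le`) and are `1 / n ^ 2` apart
(`inv_sq_le_abs_sub`). In a convolution square, pairs of distinct frequencies contribute `O(n ^ 2)`
uniformly in `t`. Among the equal pairs, which grow like `t`, only the large atom matters
(`norm_integral_charSum_mul_sub_le`).

The amplitude is thus near `L = m * (x - y) / 2` with `x`, `y` unimodular, up to the discarded mass
`1 - m`, and its derivative is near `I * t * m * L`. Since `L` is orthogonal to `I * L`, only the
discarded part contributes to the derivative of the squared modulus, at most `2 * t * m ^ 2 * (1 -
m)` (`abs_inner_le_of_two_level`). This equals `4 * t * (w ^ 4 - 2 * w ^ 2 + 1) / (2 * w ^ 6)`,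
strictly below the claimed slope, and the slack absorbs the errors linear in `t`. Short paths are
covered by the crude bound `2 * t`. -/

/-! ### Differentiating the matrix exponential -/

open intervalIntegral in
/-- Duhamel's formula. -/
theorem exp_smul_sub_exp_smul {𝔸 : Type*} [NormedRing 𝔸] [NormedAlgebra ℝ 𝔸] [CompleteSpace 𝔸]
    (X Y : 𝔸) (t : ℝ) :
    NormedSpace.exp (t • Y) - NormedSpace.exp (t • X) =
      ∫ s in (0 : ℝ)..t,
        NormedSpace.exp ((t - s) • Y) * (Y - X) * NormedSpace.exp (s • X) := by
  have hexp : ∀ Z : 𝔸, Continuous fun s : ℝ => NormedSpace.exp (s • Z) := fun Z =>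
    continuous_iff_continuousAt.2 fun s => (hasDerivAt_exp_smul_const (𝕂 := ℝ) Z s).continuousAt
  have hd : ∀ s : ℝ, HasDerivAt
      (fun s : ℝ => -(NormedSpace.exp ((t - s) • Y) * NormedSpace.exp (s • X)))
      (NormedSpace.exp ((t - s) • Y) * (Y - X) * NormedSpace.exp (s • X)) s := by
    intro s
    have h1 : HasDerivAt (fun s : ℝ => NormedSpace.exp ((t - s) • Y))
        (-(NormedSpace.exp ((t - s) • Y) * Y)) s := by
      have := (hasDerivAt_exp_smul_const (𝕂 := ℝ) Y (t - s)).scomp s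
        ((hasDerivAt_id s).const_sub t)
      simpa [Function.comp_def] using this
    have h2 := hasDerivAt_exp_smul_const' (𝕂 := ℝ) X s
    refine (h1.mul h2).neg.congr_deriv ?_
    simp only [mul_sub, sub_mul, mul_assoc, neg_mul]
    abel
  have hcont : Continuous fun s : ℝ =>
      NormedSpace.exp ((t - s) • Y) * (Y - X) * NormedSpace.exp (s • X) :=
    (((hexp Y).comp (continuous_const.sub continuous_id)).mul continuous_const).mul (hexp X)
  rw [integral_eq_sub_of_hasDerivAt (fun s _ => hd s) (hcont.intervalIntegrable _ _)]
  simp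
  abel

/-- The derivative of the exponential along an affine line. -/
theorem hasDerivAt_exp_smul_add_smul {𝔸 : Type*} [NormedRing 𝔸] [NormedAlgebra ℝ 𝔸]
    [CompleteSpace 𝔸] (X E : 𝔸) (t w : ℝ) :
    HasDerivAt (fun x : ℝ => NormedSpace.exp (t • (X + x • E)))
      (∫ s in (0 : ℝ)..t,
        NormedSpace.exp ((t - s) • (X + w • E)) * E * NormedSpace.exp (s • (X + w • E))) w := by
  let _ : NormedAlgebra ℚ 𝔸 := NormedAlgebra.restrictScalars ℚ ℝ 𝔸
  have hexp : Continuous (NormedSpace.exp : 𝔸 → 𝔸) := NormedSpace.exp_continuous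
  -- Freezing the right factor at `w` makes `Φ x` exactly the difference quotient, by Duhamel, so
  -- continuity of `Φ` suffices.
  set Φ : ℝ → 𝔸 := fun x => ∫ s in (0 : ℝ)..t,
    NormedSpace.exp ((t - s) • (X + x • E)) * E * NormedSpace.exp (s • (X + w • E)) with hΦ
  have hΦc : Continuous Φ := by
    apply intervalIntegral.continuous_parametric_intervalIntegral_of_continuous'
    unfold Function.uncurry
    exact ((hexp.comp (by fun_prop)).mul continuous_const).mul (hexp.comp (by fun_prop))
  have key : ∀ x, NormedSpace.exp (t • (X + x • E)) - NormedSpace.exp (t • (X + w • E)) =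
      (x - w) • Φ x := by
    intro x
    rw [exp_smul_sub_exp_smul, hΦ, ← intervalIntegral.integral_smul]
    congr 1
    ext s
    have : X + x • E - (X + w • E) = (x - w) • E := by rw [sub_smul]; abel
    rw [this, mul_smul_comm, smul_mul_assoc]
  rw [hasDerivAt_iff_tendsto_slope]
  refine ((hΦc.tendsto w).mono_left nhdsWithin_le_nhds).congr' ?_
  filter_upwards [self_mem_nhdsWithin] with x hx
  have hx' : x - w ≠ 0 := sub_ne_zero.2 hx
  rw [slope_def_module, key, smul_smul, inv_mul_cancel₀ hx', one_smul]

/-- The matrix with a loop at each of the two end vertices and no other edges. -/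
noncomputable def endLoops (n : ℕ) : Matrix (Fin n) (Fin n) ℝ :=
  Matrix.diagonal fun i => if i.val = 0 ∨ i.val + 1 = n then 1 else 0

theorem loopedPathMatrix_eq (n : ℕ) (w : ℝ) :
    loopedPathMatrix n w = loopedPathMatrix n 0 + w • endLoops n := by
  ext i j
  by_cases h : i = j
  · subst h; simp [loopedPathMatrix, endLoops]
  · simp [loopedPathMatrix, endLoops, h]

theorem transitionMatrix_eq {n : ℕ} (A : Matrix (Fin n) (Fin n) ℝ) (t : ℝ) :
    transitionMatrix A t = NormedSpace.exp (t • (Complex.I • A.map Complex.ofReal)) := by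
  unfold transitionMatrix
  congr 1
  ext i j
  simp
  ring

theorem map_loopedPathMatrix (n : ℕ) (w : ℝ) :
    Complex.I • (loopedPathMatrix n w).map Complex.ofReal =
      Complex.I • (loopedPathMatrix n 0).map Complex.ofReal +
        w • (Complex.I • (endLoops n).map Complex.ofReal) := by
  rw [loopedPathMatrix_eq n w]
  ext i j
  simp
  ring

section
attribute [local instance] Matrix.linftyOpNormedRing Matrix.linftyOpNormedAlgebra

/-- The matrix exponential depends only on the topology; a submultiplicative norm is chosen locally
so that the Banach algebra formula applies. -/
theorem hasDerivAt_transitionMatrix_apply (n : ℕ) (w t : ℝ) (a b : Fin n) :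
    HasDerivAt (fun x => transitionMatrix (loopedPathMatrix n x) t a b)
      (∫ s in (0 : ℝ)..t, (transitionMatrix (loopedPathMatrix n w) (t - s) *
        (Complex.I • (endLoops n).map Complex.ofReal) *
        transitionMatrix (loopedPathMatrix n w) s) a b) w := by
  simp only [transitionMatrix_eq]
  set X : Matrix (Fin n) (Fin n) ℂ := Complex.I • (loopedPathMatrix n 0).map Complex.ofReal
  set E : Matrix (Fin n) (Fin n) ℂ := Complex.I • (endLoops n).map Complex.ofReal
  have hX : ∀ x, Complex.I • (loopedPathMatrix n x).map Complex.ofReal = X + x • E :=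
    map_loopedPathMatrix n
  simp only [hX]
  have h := hasDerivAt_exp_smul_add_smul X E t w
  let L : Matrix (Fin n) (Fin n) ℂ →L[ℝ] ℂ :=
    ⟨Matrix.entryLinearMap ℝ ℂ a b, by exact continuous_id.matrix_elem a b⟩
  have h2 := L.hasFDerivAt.comp_hasDerivAt w h
  refine HasDerivAt.congr_deriv (f := fun x => NormedSpace.exp (t • (X + x • E)) a b) h2 ?_
  rw [← L.intervalIntegral_comp_comm]
  · rfl
  · let _ : NormedAlgebra ℚ (Matrix (Fin n) (Fin n) ℂ) := NormedAlgebra.restrictScalars ℚ ℝ _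
    have hexp : Continuous
      (NormedSpace.exp : Matrix (Fin n) (Fin n) ℂ → Matrix (Fin n) (Fin n) ℂ) :=
      NormedSpace.exp_continuous
    apply Continuous.intervalIntegrable
    exact ((hexp.comp (by fun_prop)).mul continuous_const).mul (hexp.comp (by fun_prop))

end

/-! ### Spectral decomposition -/

/-- A real symmetric matrix has an orthonormal eigenbasis, and its transition matrix is the
corresponding sum of exponentials. -/
theorem exists_spectral_decomposition {n : ℕ} (A : Matrix (Fin n) (Fin n) ℝ) (hA : A.IsSymm) :
    ∃ (V : Fin n → Fin n → ℝ) (ev : Fin n → ℝ),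
      (∀ k, A.mulVec (V k) = ev k • V k) ∧
      (∀ k l, ∑ j, V k j * V l j = if k = l then 1 else 0) ∧
      (∀ i j, ∑ k, V k i * V k j = if i = j then 1 else 0) ∧
      ∀ (t : ℝ) (a b : Fin n), transitionMatrix A t a b =
        ∑ k, ((V k a * V k b : ℝ) : ℂ) * Complex.exp (((t * ev k : ℝ) : ℂ) * Complex.I) := by
  have hH : A.IsHermitian := by
    rw [Matrix.IsHermitian, Matrix.conjTranspose_eq_transpose_of_trivial]; exact hA
  set U : Matrix (Fin n) (Fin n) ℝ := hH.eigenvectorUnitary.1 with hU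
  have hUU : U * U.transpose = 1 := by
    have := Matrix.mem_unitaryGroup_iff.1 hH.eigenvectorUnitary.2
    simpa [Matrix.star_eq_conjTranspose, Matrix.conjTranspose_eq_transpose_of_trivial] using this
  have hUU' : U.transpose * U = 1 := by
    have := Matrix.mem_unitaryGroup_iff'.1 hH.eigenvectorUnitary.2
    simpa [Matrix.star_eq_conjTranspose, Matrix.conjTranspose_eq_transpose_of_trivial] using this
  have hev : ∀ k, A.mulVec (U.transpose k) = hH.eigenvalues k • U.transpose k := fun k =>
    hH.mulVec_eigenvectorBasis k
  refine ⟨U.transpose, hH.eigenvalues, hev, ?_, ?_, ?_⟩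
  · intro k l
    simpa [Matrix.mul_apply, Matrix.one_apply] using congrFun (congrFun hUU' k) l
  · intro i j
    simpa [Matrix.mul_apply, Matrix.one_apply] using congrFun (congrFun hUU i) j
  · intro t a b
    have hdiag : A = U * Matrix.diagonal hH.eigenvalues * U.transpose := by
      have h1 : A * U = U * Matrix.diagonal hH.eigenvalues := by
        ext i k
        have := congrFun (hev k) i
        rw [Matrix.mul_diagonal, Matrix.mul_apply]
        simpa [Matrix.mulVec, dotProduct, mul_comm] using this
      rw [← h1, Matrix.mul_assoc, hUU, Matrix.mul_one]
    set W : Matrix (Fin n) (Fin n) ℂ := U.map Complex.ofReal with hW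
    have hmap : ∀ M N : Matrix (Fin n) (Fin n) ℝ,
        (M * N).map Complex.ofReal = M.map Complex.ofReal * N.map Complex.ofReal := fun M N =>
      Matrix.map_mul (f := Complex.ofRealHom)
    have hone : (1 : Matrix (Fin n) (Fin n) ℝ).map Complex.ofReal = 1 :=
      Matrix.map_one _ Complex.ofReal_zero Complex.ofReal_one
    have hWW : W * W.transpose = 1 := by
      rw [hW, ← Matrix.transpose_map, ← hmap, hUU, hone]
    have hinv : W⁻¹ = W.transpose := Matrix.inv_eq_right_inv hWW
    have hunit : IsUnit W := IsUnit.of_mul_eq_one _ hWW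
    have hAC : (Complex.I * (t : ℂ)) • A.map Complex.ofReal =
        W * Matrix.diagonal (fun k => ((t * hH.eigenvalues k : ℝ) : ℂ) * Complex.I) * W⁻¹ := by
      rw [hinv, congrArg (fun M => M.map Complex.ofReal) hdiag]
      simp only [hmap]
      rw [Matrix.transpose_map, ← hW, ← Matrix.smul_mul, ← Matrix.mul_smul]
      congr 2
      ext i j
      by_cases h : i = j
      · subst h; simp; ring
      · simp [h]
    rw [transitionMatrix, hAC, Matrix.exp_conj _ _ hunit, hinv, Matrix.exp_diagonal,
      Matrix.mul_apply]
    refine Finset.sum_congr rfl fun k _ => ?_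
    rw [Matrix.mul_diagonal, Pi.coe_exp, ← Complex.exp_eq_exp_ℂ]
    simp [hW]
    ring

/-! ### Eigenvectors as solutions of a three-term recurrence -/

/-- `x 0, …, x (N + 1)` satisfies the eigenvector equations of the path on `N + 2` vertices with
loops of weight `w` at its ends, up to errors `r₀` and `r₁` at the first and the last vertex. -/
structure IsApproxEigenseq (N : ℕ) (w lam r₀ r₁ : ℝ) (x : ℕ → ℝ) : Prop where
  first : w * x 0 + x 1 = lam * x 0 + r₀
  mid : ∀ j < N, x j + x (j + 2) = lam * x (j + 1)
  last : x N + w * x (N + 1) = lam * x (N + 1) + r₁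

/-- The quadratic form of the looped path, polarized. -/
def pathForm (N : ℕ) (w : ℝ) (x y : ℕ → ℝ) : ℝ :=
  w * (x 0 * y 0 + x (N + 1) * y (N + 1)) +
    ∑ j ∈ Finset.range (N + 1), (x j * y (j + 1) + x (j + 1) * y j)

/-- Pair the equation at each vertex with `y` there and sum; the errors survive only at the ends. -/
theorem IsApproxEigenseq.pathForm_eq {N : ℕ} {w lam r₀ r₁ : ℝ} {x : ℕ → ℝ}
    (h : IsApproxEigenseq N w lam r₀ r₁ x) (y : ℕ → ℝ) :
    pathForm N w x y =
      lam * ∑ j ∈ Finset.range (N + 2), x j * y j + r₀ * y 0 + r₁ * y (N + 1) := by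
  have h1 : ∑ j ∈ Finset.range N, x j * y (j + 1) + ∑ j ∈ Finset.range N, x (j + 2) * y (j + 1) =
      lam * ∑ j ∈ Finset.range N, x (j + 1) * y (j + 1) := by
    rw [← Finset.sum_add_distrib, Finset.mul_sum]
    refine Finset.sum_congr rfl fun j hj => ?_
    rw [← add_mul, h.mid j (Finset.mem_range.1 hj), mul_assoc]
  have h2 : ∑ j ∈ Finset.range (N + 2), x j * y j =
      x 0 * y 0 + ∑ j ∈ Finset.range N, x (j + 1) * y (j + 1) + x (N + 1) * y (N + 1) := by
    rw [Finset.sum_range_succ, Finset.sum_range_succ']; ring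
  rw [pathForm, Finset.sum_add_distrib, Finset.sum_range_succ,
    Finset.sum_range_succ' (fun j => x (j + 1) * y j), h2]
  linear_combination h1 + y 0 * h.first + y (N + 1) * h.last

theorem pathForm_comm (N : ℕ) (w : ℝ) (x y : ℕ → ℝ) : pathForm N w x y = pathForm N w y x := by
  unfold pathForm
  congr 1
  · ring
  · exact Finset.sum_congr rfl fun j _ => by ring

theorem sum_sq_add_sq_succ_le (N : ℕ) (x : ℕ → ℝ) :
    ∑ j ∈ Finset.range (N + 1), (x j ^ 2 + x (j + 1) ^ 2) ≤
      2 * ∑ j ∈ Finset.range (N + 2), x j ^ 2 := by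
  have h1 := Finset.sum_range_succ (fun j => x j ^ 2) (N + 1)
  have h2 := Finset.sum_range_succ' (fun j => x j ^ 2) (N + 1)
  rw [Finset.sum_add_distrib]
  nlinarith [sq_nonneg (x 0), sq_nonneg (x (N + 1))]

/-- Vanishing at the ends switches off the loops and leaves the plain path, where `2 * a * b ≤ a ^ 2
+ b ^ 2`. -/
theorem pathForm_self_le_of_eq_zero {N : ℕ} (w : ℝ) {x : ℕ → ℝ} (h0 : x 0 = 0)
    (h1 : x (N + 1) = 0) :
    pathForm N w x x ≤ 2 * ∑ j ∈ Finset.range (N + 2), x j ^ 2 := by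
  refine le_trans ?_ (sum_sq_add_sq_succ_le N x)
  rw [pathForm, h0, h1]
  simp only [mul_zero, add_zero, zero_add]
  exact Finset.sum_le_sum fun j _ => by nlinarith [sq_nonneg (x j - x (j + 1))]

theorem neg_two_mul_le_pathForm_self (N : ℕ) {w : ℝ} (hw : 0 ≤ w) (x : ℕ → ℝ) :
    -(2 * ∑ j ∈ Finset.range (N + 2), x j ^ 2) ≤ pathForm N w x x := by
  refine (neg_le_neg (sum_sq_add_sq_succ_le N x)).trans ?_
  rw [pathForm, ← Finset.sum_neg_distrib]
  have h1 : ∑ j ∈ Finset.range (N + 1), -(x j ^ 2 + x (j + 1) ^ 2) ≤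
      ∑ j ∈ Finset.range (N + 1), (x j * x (j + 1) + x (j + 1) * x j) :=
    Finset.sum_le_sum fun j _ => by nlinarith [sq_nonneg (x j + x (j + 1))]
  nlinarith [mul_nonneg hw (add_nonneg (mul_self_nonneg (x 0)) (mul_self_nonneg (x (N + 1))))]

/-- Exact eigensequences. -/
abbrev IsEigenseq (N : ℕ) (w lam : ℝ) (x : ℕ → ℝ) : Prop := IsApproxEigenseq N w lam 0 0 x

namespace IsApproxEigenseq

variable {N : ℕ} {w lam lam' : ℝ} {x y : ℕ → ℝ}

theorem linear_comb (hx : IsEigenseq N w lam x) (hy : IsEigenseq N w lam y) (a b : ℝ) :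
    IsEigenseq N w lam (fun j => a * x j + b * y j) where
  first := by linear_combination a * hx.first + b * hy.first
  mid j hj := by linear_combination a * hx.mid j hj + b * hy.mid j hj
  last := by linear_combination a * hx.last + b * hy.last

theorem reflect (hx : IsEigenseq N w lam x) : IsEigenseq N w lam (fun j => x (N + 1 - j)) where
  first := by
    have := hx.last
    simp only [Nat.sub_zero, Nat.add_sub_cancel]
    linarith
  mid j hj := by
    obtain ⟨i, rfl⟩ : ∃ i, N = i + j + 1 := ⟨N - j - 1, by omega⟩
    have := hx.mid i (by omega)
    have e1 : i + j + 1 + 1 - j = i + 2 := by omega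
    have e2 : i + j + 1 + 1 - (j + 2) = i := by omega
    have e3 : i + j + 1 + 1 - (j + 1) = i + 1 := by omega
    simp only [e1, e2, e3]
    linarith
  last := by
    have := hx.first
    have e1 : N + 1 - N = 1 := by omega
    simp only [e1, Nat.sub_self]
    linarith

theorem eq_zero (hx : IsEigenseq N w lam x) (h0 : x 0 = 0) : ∀ j ≤ N + 1, x j = 0 := by
  have h1 : x 1 = 0 := by have := hx.first; simpa [h0] using this
  have key : ∀ j ≤ N, x j = 0 ∧ x (j + 1) = 0 := by
    intro j
    induction j with
    | zero => exact fun _ => ⟨h0, h1⟩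
    | succ j ih =>
      intro hj
      obtain ⟨ha, hb⟩ := ih (by omega)
      refine ⟨hb, ?_⟩
      have := hx.mid j (by omega)
      simpa [ha, hb] using this
  rintro (_ | j) hj
  · exact h0
  · exact (key j (by omega)).2

/-- Two eigensequences for the same eigenvalue are proportional. -/
theorem proportional (hx : IsEigenseq N w lam x) (hy : IsEigenseq N w lam y) :
    ∀ j ≤ N + 1, y 0 * x j = x 0 * y j := by
  intro j hj
  have := (hx.linear_comb hy (y 0) (-x 0)).eq_zero (by ring) j hj
  linarith

/-- Reflection preserves eigensequences and eigenvalues are simple; at the last vertex this yields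
the dichotomy even or odd. -/
theorem reflect_proportional (hx : IsEigenseq N w lam x) :
    ∀ j ≤ N + 1, x (N + 1) * x j = x 0 * x (N + 1 - j) := by
  simpa using hx.proportional hx.reflect

theorem last_eq (hx : IsEigenseq N w lam x) : x (N + 1) = x 0 ∨ x (N + 1) = -x 0 := by
  have := hx.reflect_proportional (N + 1) le_rfl
  rw [Nat.sub_self] at this
  exact sq_eq_sq_iff_eq_or_eq_neg.1 (by rw [sq, sq, this])

theorem zero_ne (hx : IsEigenseq N w lam x) (h1 : ∑ j ∈ Finset.range (N + 2), x j * x j = 1) :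
    x 0 ≠ 0 := by
  intro h0
  rw [Finset.sum_eq_zero] at h1
  · exact zero_ne_one h1
  · intro j hj
    rw [hx.eq_zero h0 j (by have := Finset.mem_range.1 hj; omega), zero_mul]

theorem neg_two_le (hw : 0 ≤ w) (hx : IsEigenseq N w lam x)
    (h1 : ∑ j ∈ Finset.range (N + 2), x j * x j = 1) : -2 ≤ lam := by
  have h := hx.pathForm_eq x
  have h2 := neg_two_mul_le_pathForm_self N hw x
  simp only [sq] at h2
  rw [h1] at h h2
  linarith

/-- The quantity `x j ^ 2 + x (j + 1) ^ 2 - lam * x j * x (j + 1)` is conserved, so that bulk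
eigenvectors are spread out over the whole path. -/
theorem sq_zero_le (hw : 1 < w) (hx : IsEigenseq N w lam x) (hl : |lam| ≤ 2)
    (h1 : ∑ j ∈ Finset.range (N + 2), x j * x j = 1) :
    x 0 ^ 2 ≤ 4 / ((N + 1) * (w - 1) ^ 2) := by
  obtain ⟨hl1, hl2⟩ := abs_le.1 hl
  have hc : ∀ j ≤ N, x j ^ 2 + x (j + 1) ^ 2 - lam * (x j * x (j + 1)) =
      x 0 ^ 2 * (1 + w ^ 2 - lam * w) := by
    intro j
    induction j with
    | zero =>
      intro _
      have : x 1 = (lam - w) * x 0 := by linear_combination hx.first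
      simp only [zero_add, this]
      ring
    | succ j ih =>
      intro hj
      rw [← ih (by omega)]
      have : x (j + 2) = lam * x (j + 1) - x j := by linear_combination hx.mid j (by omega)
      simp only [add_assoc, Nat.reduceAdd, this]
      ring
  have hb : ∀ j ∈ Finset.range (N + 1),
      x 0 ^ 2 * (w - 1) ^ 2 ≤ 2 * (x j ^ 2 + x (j + 1) ^ 2) := by
    intro j hj
    have := hc j (by have := Finset.mem_range.1 hj; omega)
    have h3 : x 0 ^ 2 * (w - 1) ^ 2 ≤ x 0 ^ 2 * (1 + w ^ 2 - lam * w) :=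
      mul_le_mul_of_nonneg_left (by nlinarith) (sq_nonneg _)
    -- `a ^ 2 + b ^ 2 + lam * a * b` is a nonnegative combination of `(a - b) ^ 2` and `(a + b) ^
    -- 2`, so the conserved quantity is at most `2 * (a ^ 2 + b ^ 2)`.
    nlinarith [mul_nonneg (sub_nonneg.2 hl2) (sq_nonneg (x j - x (j + 1))),
      mul_nonneg (by linarith : 0 ≤ 2 + lam) (sq_nonneg (x j + x (j + 1)))]
  have hs := Finset.sum_le_sum hb
  rw [Finset.sum_const, Finset.card_range, nsmul_eq_mul, ← Finset.mul_sum] at hs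
  have h4 := sum_sq_add_sq_succ_le N x
  simp only [← sq] at h1
  rw [h1] at h4
  have hp : 0 < ((N : ℝ) + 1) * (w - 1) ^ 2 := by
    have : 0 < w - 1 := by linarith
    positivity
  rw [le_div_iff₀ hp]
  push_cast at hs
  linarith

/-- In each of the two symmetry classes at most one eigenvalue exceeds `2`. -/
theorem le_two_of_orthonormal (hx : IsEigenseq N w lam x) (hy : IsEigenseq N w lam' y)
    (hx1 : ∑ j ∈ Finset.range (N + 2), x j * x j = 1)
    (hy1 : ∑ j ∈ Finset.range (N + 2), y j * y j = 1)
    (hxy : ∑ j ∈ Finset.range (N + 2), x j * y j = 0) {σ : ℝ}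
    (hxσ : x (N + 1) = σ * x 0) (hyσ : y (N + 1) = σ * y 0) (hl : 2 < lam) : lam' ≤ 2 := by
  by_contra! hl'
  have hx0 := hx.zero_ne hx1
  -- The combination `y 0 * x - x 0 * y` vanishes at both ends, because the symmetry class is the
  -- same, so its form is at most twice its squared norm. By orthonormality the form is `lam * y 0 ^
  -- 2 + lam' * x 0 ^ 2`, which is too large if both eigenvalues exceed `2`.
  have hB : pathForm N w (fun j => y 0 * x j - x 0 * y j) (fun j => y 0 * x j - x 0 * y j) =
      y 0 ^ 2 * pathForm N w x x + x 0 ^ 2 * pathForm N w y y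
        - 2 * (x 0 * y 0) * pathForm N w x y := by
    have : ∀ j, (y 0 * x j - x 0 * y j) * (y 0 * x (j + 1) - x 0 * y (j + 1)) +
        (y 0 * x (j + 1) - x 0 * y (j + 1)) * (y 0 * x j - x 0 * y j) =
        y 0 ^ 2 * (x j * x (j + 1) + x (j + 1) * x j) +
        x 0 ^ 2 * (y j * y (j + 1) + y (j + 1) * y j) -
        2 * (x 0 * y 0) * (x j * y (j + 1) + x (j + 1) * y j) := fun j => by ring
    simp only [pathForm, this, Finset.sum_sub_distrib, Finset.sum_add_distrib (f := fun j =>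
      y 0 ^ 2 * _), ← Finset.mul_sum]
    ring
  have hS : ∑ j ∈ Finset.range (N + 2), (y 0 * x j - x 0 * y j) ^ 2 = y 0 ^ 2 + x 0 ^ 2 := by
    have : ∀ j, (y 0 * x j - x 0 * y j) ^ 2 = y 0 ^ 2 * (x j * x j) + x 0 ^ 2 * (y j * y j)
        - 2 * (x 0 * y 0) * (x j * y j) := fun j => by ring
    simp only [this, Finset.sum_sub_distrib, Finset.sum_add_distrib, ← Finset.mul_sum, hx1, hy1,
      hxy]
    ring
  have h := pathForm_self_le_of_eq_zero (N := N) w (x := fun j => y 0 * x j - x 0 * y j)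
    (by ring) (by simp only [hxσ, hyσ]; ring)
  rw [hS, hB, hx.pathForm_eq, hx.pathForm_eq, hy.pathForm_eq, hx1, hy1, hxy] at h
  have : 0 < x 0 ^ 2 := by positivity
  nlinarith [mul_pos this (sub_pos.2 hl'), mul_nonneg (sq_nonneg (y 0)) (sub_pos.2 hl).le]

end IsApproxEigenseq

/-! ### Chebyshev recurrence and the gap between bulk eigenvalues -/

/-- Chebyshev polynomials of the second kind, shifted by one and evaluated at `lam / 2`. -/
def shiftedCheb (lam : ℝ) : ℕ → ℝ
  | 0 => 0
  | 1 => 1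
  | j + 2 => lam * shiftedCheb lam (j + 1) - shiftedCheb lam j

theorem shiftedCheb_conserved (lam : ℝ) (j : ℕ) :
    shiftedCheb lam j ^ 2 + shiftedCheb lam (j + 1) ^ 2 -
      lam * (shiftedCheb lam j * shiftedCheb lam (j + 1)) = 1 := by
  induction j with
  | zero => simp [shiftedCheb]
  | succ j ih =>
    rw [← ih, shiftedCheb]
    ring

/-- Completing the square in the conserved quantity gives `(b - lam / 2 * a) ^ 2 ≤ 1` for
consecutive terms `a`, `b`, hence `|b| ≤ |a| + 1`. -/
theorem abs_shiftedCheb_le {lam : ℝ} (hl : |lam| ≤ 2) (j : ℕ) : |shiftedCheb lam j| ≤ j := by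
  obtain ⟨hl1, hl2⟩ := abs_le.1 hl
  induction j with
  | zero => simp [shiftedCheb]
  | succ j ih =>
    have hc := shiftedCheb_conserved lam j
    set a := shiftedCheb lam j
    set b := shiftedCheb lam (j + 1)
    have hq : |b - lam / 2 * a| ≤ 1 := by
      rw [← sq_le_one_iff_abs_le_one]
      nlinarith [mul_nonneg (by nlinarith : 0 ≤ 1 - lam ^ 2 / 4) (sq_nonneg a)]
    have h2 : |lam / 2 * a| ≤ |a| := by
      rw [abs_mul]
      refine mul_le_of_le_one_left (abs_nonneg a) ?_
      rw [abs_div, abs_two]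
      linarith
    have h3 : |b| ≤ |b - lam / 2 * a| + |lam / 2 * a| := by
      simpa using abs_add_le (b - lam / 2 * a) (lam / 2 * a)
    push_cast
    linarith

/-- Variation of constants. -/
theorem forced_recurrence_eq {N : ℕ} {lam : ℝ} {u f : ℕ → ℝ} (h0 : u 0 = 0) (h1 : u 1 = f 0)
    (h2 : ∀ j < N, u (j + 2) = lam * u (j + 1) - u j + f (j + 1)) :
    ∀ j ≤ N + 1, u j = ∑ i ∈ Finset.range j, shiftedCheb lam (j - i) * f i := by
  have key : ∀ j ≤ N, u j = ∑ i ∈ Finset.range j, shiftedCheb lam (j - i) * f i ∧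
      u (j + 1) = ∑ i ∈ Finset.range (j + 1), shiftedCheb lam (j + 1 - i) * f i := by
    intro j
    induction j with
    | zero => intro _; simp [h0, h1, shiftedCheb]
    | succ j ih =>
      intro hj
      obtain ⟨ha, hb⟩ := ih (by omega)
      refine ⟨hb, ?_⟩
      rw [h2 j (by omega), hb, ha, Finset.sum_range_succ, Finset.sum_range_succ _ (j + 1),
        Finset.sum_range_succ _ j]
      have e1 : j + 1 - j = 1 := by omega
      have e2 : j + 1 + 1 - (j + 1) = 1 := by omega
      have e3 : j + 1 + 1 - j = 2 := by omega
      have hs : ∑ i ∈ Finset.range j, shiftedCheb lam (j + 1 + 1 - i) * f i =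
          lam * ∑ i ∈ Finset.range j, shiftedCheb lam (j + 1 - i) * f i -
            ∑ i ∈ Finset.range j, shiftedCheb lam (j - i) * f i := by
        rw [Finset.mul_sum, ← Finset.sum_sub_distrib]
        refine Finset.sum_congr rfl fun i hi => ?_
        have hi := Finset.mem_range.1 hi
        obtain ⟨d, rfl⟩ : ∃ d, j = i + d := ⟨j - i, by omega⟩
        have e1 : i + d + 1 + 1 - i = d + 2 := by omega
        have e2 : i + d + 1 - i = d + 1 := by omega
        have e3 : i + d - i = d := by omega
        rw [e1, e2, e3, shiftedCheb]
        ring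
      rw [e1, e2, e3, hs]
      simp [shiftedCheb]
      ring
  rintro (_ | j) hj
  · simpa using h0
  · exact (key j (by omega)).2

/-- The Chebyshev kernel is at most `N + 2`. This enters squared; Cauchy–Schwarz for the sum over
`f` and the final sum over `j` each cost one more factor `N + 2`. -/
theorem sq_forced_recurrence_le {N : ℕ} {lam : ℝ} (hl : |lam| ≤ 2) {u f : ℕ → ℝ} (h0 : u 0 = 0)
    (h1 : u 1 = f 0) (h2 : ∀ j < N, u (j + 2) = lam * u (j + 1) - u j + f (j + 1)) :
    ∑ j ∈ Finset.range (N + 2), u j ^ 2 ≤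
      ((N : ℝ) + 2) ^ 4 * ∑ j ∈ Finset.range (N + 2), f j ^ 2 := by
  set F := ∑ j ∈ Finset.range (N + 2), |f j| with hF
  have hF0 : 0 ≤ F := Finset.sum_nonneg fun _ _ => abs_nonneg _
  have hF2 : F ^ 2 ≤ ((N : ℝ) + 2) * ∑ j ∈ Finset.range (N + 2), f j ^ 2 := by
    have := sq_sum_le_card_mul_sum_sq (s := Finset.range (N + 2)) (f := fun j => |f j|)
    simpa [hF] using this
  have hu : ∀ j ∈ Finset.range (N + 2), u j ^ 2 ≤ (((N : ℝ) + 2) * F) ^ 2 := by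
    intro j hj
    have hj := Finset.mem_range.1 hj
    rw [← sq_abs]
    refine pow_le_pow_left₀ (abs_nonneg _) ?_ 2
    rw [forced_recurrence_eq h0 h1 h2 j (by omega)]
    refine (Finset.abs_sum_le_sum_abs _ _).trans ?_
    rw [hF, Finset.mul_sum]
    refine (Finset.sum_le_sum (g := fun i => ((N : ℝ) + 2) * |f i|) fun i hi => ?_).trans
      (Finset.sum_le_sum_of_subset_of_nonneg ?_ fun i _ _ => by positivity)
    · rw [abs_mul]
      refine mul_le_mul_of_nonneg_right ((abs_shiftedCheb_le hl _).trans ?_) (abs_nonneg _)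
      have : j - i ≤ N + 2 := by omega
      exact_mod_cast this
    · exact Finset.range_subset_range.2 (by omega)
  refine (Finset.sum_le_sum hu).trans ?_
  rw [Finset.sum_const, Finset.card_range, nsmul_eq_mul, mul_pow]
  push_cast
  have hn : 0 ≤ ((N : ℝ) + 2) ^ 3 := by positivity
  nlinarith [mul_le_mul_of_nonneg_left hF2 hn]

namespace IsApproxEigenseq

variable {N : ℕ} {w lam lam' : ℝ} {x y : ℕ → ℝ}

/-- The combination `y 0 * x - x 0 * y` starts at `0` and solves the `lam` recurrence with forcing
`(lam - lam') * x 0 * y`. Its squared norm `y 0 ^ 2 + x 0 ^ 2` cannot be small, so the forcing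
cannot be either. -/
theorem inv_sq_le_abs_sub_of_sq_le (hx : IsEigenseq N w lam x) (hy : IsEigenseq N w lam' y)
    (hx1 : ∑ j ∈ Finset.range (N + 2), x j * x j = 1)
    (hy1 : ∑ j ∈ Finset.range (N + 2), y j * y j = 1)
    (hxy : ∑ j ∈ Finset.range (N + 2), x j * y j = 0)
    (hl : |lam| ≤ 2) (h : x 0 ^ 2 ≤ y 0 ^ 2) :
    1 / ((N : ℝ) + 2) ^ 2 ≤ |lam - lam'| := by
  have hy0 : 0 < y 0 ^ 2 := by have := hy.zero_ne hy1; positivity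
  have hS : ∑ j ∈ Finset.range (N + 2), (y 0 * x j - x 0 * y j) ^ 2 = y 0 ^ 2 + x 0 ^ 2 := by
    have : ∀ j, (y 0 * x j - x 0 * y j) ^ 2 = y 0 ^ 2 * (x j * x j) + x 0 ^ 2 * (y j * y j)
        - 2 * (x 0 * y 0) * (x j * y j) := fun j => by ring
    simp only [this, Finset.sum_sub_distrib, Finset.sum_add_distrib, ← Finset.mul_sum, hx1, hy1,
      hxy]
    ring
  have key := sq_forced_recurrence_le (N := N) hl (u := fun j => y 0 * x j - x 0 * y j)
    (f := fun j => (lam - lam') * x 0 * y j) (by ring)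
    (by linear_combination y 0 * hx.first - x 0 * hy.first)
    (fun j hj => by linear_combination y 0 * hx.mid j hj - x 0 * hy.mid j hj)
  have hf : ∑ j ∈ Finset.range (N + 2), ((lam - lam') * x 0 * y j) ^ 2 =
      (lam - lam') ^ 2 * x 0 ^ 2 := by
    have : ∀ j, ((lam - lam') * x 0 * y j) ^ 2 = (lam - lam') ^ 2 * x 0 ^ 2 * (y j * y j) :=
      fun j => by ring
    simp only [this, ← Finset.mul_sum, hy1, mul_one]
  rw [hS, hf] at key
  have hpos : 0 < ((N : ℝ) + 2) ^ 2 := by positivity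
  have h3 : 1 ≤ (((N : ℝ) + 2) ^ 2 * |lam - lam'|) ^ 2 := by
    rw [mul_pow, sq_abs]
    have h4 : 0 ≤ (((N : ℝ) + 2) ^ 2) ^ 2 * (lam - lam') ^ 2 := by positivity
    have h5 := mul_le_mul_of_nonneg_left h h4
    refine le_of_mul_le_mul_right ?_ hy0
    nlinarith [sq_nonneg (x 0)]
  rw [div_le_iff₀ hpos, mul_comm]
  exact (one_le_sq_iff₀ (by positivity)).1 h3

/-- Distinct bulk eigenvalues are at least `1 / n ^ 2` apart. -/
theorem inv_sq_le_abs_sub (hx : IsEigenseq N w lam x) (hy : IsEigenseq N w lam' y)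
    (hx1 : ∑ j ∈ Finset.range (N + 2), x j * x j = 1)
    (hy1 : ∑ j ∈ Finset.range (N + 2), y j * y j = 1)
    (hxy : ∑ j ∈ Finset.range (N + 2), x j * y j = 0)
    (hl : |lam| ≤ 2) (hl' : |lam'| ≤ 2) :
    1 / ((N : ℝ) + 2) ^ 2 ≤ |lam - lam'| := by
  rcases le_total (x 0 ^ 2) (y 0 ^ 2) with h | h
  · exact hx.inv_sq_le_abs_sub_of_sq_le hy hx1 hy1 hxy hl h
  · rw [abs_sub_comm]
    exact hy.inv_sq_le_abs_sub_of_sq_le hx hy1 hx1 (by simpa only [mul_comm] using hxy) hl' h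

end IsApproxEigenseq

/-! ### From matrix eigenvectors to eigensequences -/

/-- An orthonormal basis of eigenvectors of the looped path on `N + 2` vertices, each of them
written as a sequence indexed by `ℕ`. -/
structure IsPathEigenbasis (N : ℕ) (w : ℝ) (X : Fin (N + 2) → ℕ → ℝ) (ev : Fin (N + 2) → ℝ) :
    Prop where
  eigen : ∀ k, IsEigenseq N w (ev k) (X k)
  orthonormal : ∀ k l, ∑ j ∈ Finset.range (N + 2), X k j * X l j = if k = l then 1 else 0
  complete : ∀ i < N + 2, ∀ j < N + 2, ∑ k, X k i * X k j = if i = j then 1 else 0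

/-- Extension of a vector to a sequence by zeros. -/
def zeroExtend {n : ℕ} (v : Fin n → ℝ) (j : ℕ) : ℝ := if h : j < n then v ⟨j, h⟩ else 0

theorem zeroExtend_coe {n : ℕ} (v : Fin n → ℝ) (j : Fin n) : zeroExtend v j = v j := by
  simp [zeroExtend]

theorem loopedPathMatrix_mulVec {N : ℕ} (w : ℝ) (v : Fin (N + 2) → ℝ) (i : Fin (N + 2)) :
    (loopedPathMatrix (N + 2) w).mulVec v i =
      ∑ j ∈ Finset.range (N + 2),
        ((if i.val = j then (if i.val = 0 ∨ i.val = N + 1 then w else 0) * zeroExtend v j else 0) +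
          (if i.val + 1 = j then zeroExtend v j else 0) +
          if j + 1 = i.val then zeroExtend v j else 0) := by
  rw [← Fin.sum_univ_eq_sum_range (fun j =>
        ((if i.val = j then (if i.val = 0 ∨ i.val = N + 1 then w else 0) * zeroExtend v j else 0) +
          (if i.val + 1 = j then zeroExtend v j else 0) +
          if j + 1 = i.val then zeroExtend v j else 0))]
  rw [Matrix.mulVec, dotProduct]
  refine Finset.sum_congr rfl fun j _ => ?_
  simp only [loopedPathMatrix, Matrix.of_apply, zeroExtend_coe, Fin.ext_iff]
  have e : i.val + 1 = N + 2 ↔ i.val = N + 1 := by omega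
  simp only [e]
  by_cases h1 : i.val = j.val
  · have h2 : ¬ i.val + 1 = j.val := by omega
    have h3 : ¬ j.val + 1 = i.val := by omega
    rw [if_pos h1, if_pos h1, if_neg h2, if_neg h3, add_zero, add_zero]
  · by_cases h2 : i.val + 1 = j.val
    · have h3 : ¬ j.val + 1 = i.val := by omega
      rw [if_neg h1, if_neg h1, if_pos (Or.inl h2), if_pos h2, if_neg h3]; ring
    · by_cases h3 : j.val + 1 = i.val
      · rw [if_neg h1, if_neg h1, if_pos (Or.inr h3), if_neg h2, if_pos h3]; ring
      · rw [if_neg h1, if_neg h1, if_neg (not_or.2 ⟨h2, h3⟩), if_neg h2, if_neg h3]; ring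

theorem isEigenseq_zeroExtend {N : ℕ} {w lam : ℝ} {v : Fin (N + 2) → ℝ}
    (h : (loopedPathMatrix (N + 2) w).mulVec v = lam • v) :
    IsEigenseq N w lam (zeroExtend v) := by
  have key : ∀ i (hi : i < N + 2), ∑ j ∈ Finset.range (N + 2),
        ((if i = j then (if i = 0 ∨ i = N + 1 then w else 0) * zeroExtend v j else 0) +
          (if i + 1 = j then zeroExtend v j else 0) +
          if j + 1 = i then zeroExtend v j else 0) = lam * zeroExtend v i := by
    intro i hi
    have := congrFun h ⟨i, hi⟩
    rw [loopedPathMatrix_mulVec] at this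
    simpa [zeroExtend, hi] using this
  refine ⟨?_, fun i hi => ?_, ?_⟩
  · have := key 0 (by omega)
    simp only [Finset.sum_add_distrib, Finset.sum_ite_eq] at this
    simpa using this
  · have := key (i + 1) (by omega)
    have e : ¬ (i + 1 = 0 ∨ i = N) := by omega
    have e1 : i + 1 < N + 2 := by omega
    have e2 : i + 1 + 1 < N + 2 := by omega
    have e3 : i < N + 2 := by omega
    simp only [Finset.sum_add_distrib, Finset.sum_ite_eq, add_left_inj, Finset.sum_ite_eq',
      if_neg e, Finset.mem_range, if_pos e1, if_pos e2, if_pos e3] at this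
    linarith
  · have := key (N + 1) (by omega)
    have e1 : N + 1 < N + 2 := by omega
    have e2 : ¬ N + 1 + 1 < N + 2 := by omega
    have e3 : N < N + 2 := by omega
    simp only [Finset.sum_add_distrib, Finset.sum_ite_eq, add_left_inj, Finset.sum_ite_eq',
      Finset.mem_range, if_pos e1, if_neg e2, if_pos e3, or_true, if_true] at this
    linarith

/-! ### Trial vectors localized at the ends -/

/-- A vector of the form `q ^ j + σ * q ^ (N + 1 - j)`, localized at both ends. -/
def endMode (N : ℕ) (q σ : ℝ) (j : ℕ) : ℝ := q ^ j + σ * q ^ (N + 1 - j)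

/-- The decaying profile `w⁻¹ ^ j` solves the first and the bulk equations exactly. Each residual
comes from the tail of the profile centred at the opposite end. -/
theorem isApproxEigenseq_endMode (N : ℕ) {w σ : ℝ} (hw : w ≠ 0) (hσ : σ ^ 2 = 1) :
    IsApproxEigenseq N w (w + w⁻¹) (σ * (w⁻¹ ^ N - w⁻¹ ^ (N + 2)))
      (σ * (σ * (w⁻¹ ^ N - w⁻¹ ^ (N + 2)))) (endMode N w⁻¹ σ) where
  first := by
    simp only [endMode, Nat.sub_zero, Nat.add_sub_cancel]
    ring
  mid j hj := by
    obtain ⟨i, rfl⟩ : ∃ i, N = i + j + 1 := ⟨N - j - 1, by omega⟩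
    have e0 : i + j + 1 + 1 - j = i + 2 := by omega
    have e1 : i + j + 1 + 1 - (j + 2) = i := by omega
    have e2 : i + j + 1 + 1 - (j + 1) = i + 1 := by omega
    simp only [endMode, e0, e1, e2]
    have hq : w * w⁻¹ = 1 := mul_inv_cancel₀ hw
    linear_combination (-w⁻¹ ^ j - σ * w⁻¹ ^ i) * hq
  last := by
    have e : N + 1 - N = 1 := by omega
    simp only [endMode, e, Nat.sub_self]
    linear_combination (-w⁻¹ ^ N + w⁻¹ ^ (N + 2)) * hσ

theorem sum_sq_endMode (N : ℕ) (q : ℝ) {σ : ℝ} (hσ : σ ^ 2 = 1) :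
    (1 - q ^ 2) * ∑ j ∈ Finset.range (N + 2), endMode N q σ j ^ 2 =
      2 * (1 - q ^ (2 * (N + 2))) + 2 * σ * (1 - q ^ 2) * (((N : ℝ) + 2) * q ^ (N + 1)) := by
  have hg : (1 - q ^ 2) * ∑ j ∈ Finset.range (N + 2), (q ^ 2) ^ j = 1 - q ^ (2 * (N + 2)) := by
    rw [mul_neg_geom_sum, pow_mul]
  have hr := Finset.sum_range_reflect (fun j => (q ^ 2) ^ j) (N + 2)
  have e : ∀ j ∈ Finset.range (N + 2), endMode N q σ j ^ 2 =
      (q ^ 2) ^ j + (q ^ 2) ^ (N + 2 - 1 - j) + 2 * σ * q ^ (N + 1) := by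
    intro j hj
    have hj := Finset.mem_range.1 hj
    have e1 : q ^ (N + 1) = q ^ j * q ^ (N + 1 - j) := by rw [← pow_add]; congr 1; omega
    rw [e1, endMode, ← pow_mul, ← pow_mul, mul_comm 2, mul_comm 2, pow_mul, pow_mul,
      show N + 2 - 1 - j = N + 1 - j by omega]
    linear_combination (q ^ (N + 1 - j)) ^ 2 * hσ
  rw [Finset.sum_congr rfl e, Finset.sum_add_distrib, Finset.sum_add_distrib, hr,
    Finset.sum_const, Finset.card_range, nsmul_eq_mul]
  push_cast
  linear_combination 2 * hg

theorem abs_sum_sq_endMode_sub_two_le {N : ℕ} {q σ κ : ℝ} (hq0 : 0 < q) (hq1 : q < 1)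
    (hσ : σ ^ 2 = 1) (hκ : ((N : ℝ) + 2) * q ^ N ≤ κ) :
    |(1 - q ^ 2) * (∑ j ∈ Finset.range (N + 2), endMode N q σ j ^ 2) - 2| ≤ 4 * κ := by
  have hqκ : q ^ N ≤ κ := by
    have : (0 : ℝ) ≤ N := by positivity
    have : 0 < q ^ N := by positivity
    nlinarith
  have hσ1 : |σ| = 1 := by
    rw [← pow_eq_one_iff_of_nonneg (abs_nonneg σ) two_ne_zero, sq_abs, hσ]
  have hq2 : 0 < 1 - q ^ 2 := by nlinarith
  rw [sum_sq_endMode N q hσ]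
  have h1 : q ^ (2 * (N + 2)) ≤ κ :=
    (pow_le_pow_of_le_one hq0.le hq1.le (show N ≤ 2 * (N + 2) by omega)).trans hqκ
  have h2 : ((N : ℝ) + 2) * q ^ (N + 1) ≤ κ :=
    (mul_le_mul_of_nonneg_left
      (pow_le_pow_of_le_one hq0.le hq1.le (show N ≤ N + 1 by omega)) (by positivity)).trans hκ
  have h3 : |2 * σ * (1 - q ^ 2) * (((N : ℝ) + 2) * q ^ (N + 1))| ≤ 2 * κ := by
    rw [abs_mul, abs_mul, abs_mul, hσ1, abs_two, abs_of_pos hq2,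
      abs_of_pos (by positivity : 0 < ((N : ℝ) + 2) * q ^ (N + 1))]
    have : 0 < ((N : ℝ) + 2) * q ^ (N + 1) := by positivity
    nlinarith [sq_nonneg q]
  have h4 : 0 < q ^ (2 * (N + 2)) := by positivity
  rw [abs_le] at h3 ⊢
  constructor <;> linarith

/-- Arithmetic for `exists_top`: `S` is the squared norm of the trial vector, `c` its overlap with
the top eigenvector and `v` the end entry of the latter. From `p * c ^ 2 ≈ 2` and `c * v ≈ 1`
follows `2 * v ^ 2 ≈ p`. -/
theorem abs_two_mul_sq_sub_le {p c v S κ e : ℝ} (hp0 : 0 < p) (hp1 : p ≤ 1) (hκ0 : 0 < κ)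
    (hκ1 : κ ≤ 1 / 8) (he0 : 0 < e) (he1 : e ≤ 1 / 4) (hv1 : v ^ 2 ≤ 1)
    (hS : |p * S - 2| ≤ 4 * κ) (hA : |c ^ 2 - S| ≤ e ^ 2) (hB : |c * v - 1| ≤ κ + e) :
    |2 * v ^ 2 - p| ≤ 7 * κ + 7 / 2 * e := by
  have hC : |(c * v) ^ 2 - 1| ≤ 3 * (κ + e) := by
    have : (c * v) ^ 2 - 1 = (c * v - 1) * (c * v - 1 + 2) := by ring
    rw [this, abs_mul, mul_comm]
    refine mul_le_mul ?_ hB (abs_nonneg _) (by norm_num)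
    refine (abs_add_le _ _).trans ?_
    rw [abs_two]
    linarith
  have hD : |p * c ^ 2 - 2| ≤ 4 * κ + e ^ 2 := by
    have : p * c ^ 2 - 2 =
        (p * S - 2) + p * (c ^ 2 - S) := by ring
    rw [this]
    refine (abs_add_le _ _).trans (add_le_add hS ?_)
    rw [abs_mul, abs_of_pos hp0]
    exact (mul_le_of_le_one_left (abs_nonneg _) hp1).trans hA
  have hfin : 2 * v ^ 2 - p = -(v ^ 2 * (p * c ^ 2 - 2)) +
      p * ((c * v) ^ 2 - 1) := by ring
  rw [hfin]
  refine (abs_add_le _ _).trans ?_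
  rw [abs_neg, abs_mul, abs_mul, abs_of_pos hp0, abs_of_nonneg (sq_nonneg (v))]
  have h5 := (mul_le_of_le_one_left (abs_nonneg _) hv1).trans hD
  have h6 := (mul_le_of_le_one_left (abs_nonneg ((c * v) ^ 2 - 1))
    hp1).trans hC
  nlinarith

/-! ### The eigenvalue above the bulk in each symmetry class -/

namespace IsPathEigenbasis

variable {N : ℕ} {w : ℝ} {X : Fin (N + 2) → ℕ → ℝ} {ev : Fin (N + 2) → ℝ}

theorem sum_coeff_mul (h : IsPathEigenbasis N w X ev) (φ : ℕ → ℝ) {i : ℕ} (hi : i < N + 2) :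
    ∑ k, (∑ j ∈ Finset.range (N + 2), φ j * X k j) * X k i = φ i := by
  simp only [Finset.sum_mul]
  rw [Finset.sum_comm]
  have : ∀ j ∈ Finset.range (N + 2), ∑ k, φ j * X k j * X k i = if j = i then φ j else 0 := by
    intro j hj
    simp only [mul_assoc]
    rw [← Finset.mul_sum, h.complete j (Finset.mem_range.1 hj) i hi]
    simp
  rw [Finset.sum_congr rfl this, Finset.sum_ite_eq' _ i, if_pos (Finset.mem_range.2 hi)]

theorem sum_coeff_sq (h : IsPathEigenbasis N w X ev) (φ : ℕ → ℝ) :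
    ∑ k, (∑ j ∈ Finset.range (N + 2), φ j * X k j) ^ 2 =
      ∑ j ∈ Finset.range (N + 2), φ j ^ 2 := by
  have : ∀ k, (∑ j ∈ Finset.range (N + 2), φ j * X k j) ^ 2 =
      ∑ i ∈ Finset.range (N + 2),
        φ i * ((∑ j ∈ Finset.range (N + 2), φ j * X k j) * X k i) := by
    intro k
    rw [sq]
    nth_rewrite 2 [Finset.sum_congr rfl fun i _ => rfl]
    rw [Finset.mul_sum]
    exact Finset.sum_congr rfl fun i _ => by ring
  simp only [this]
  rw [Finset.sum_comm]
  refine Finset.sum_congr rfl fun i hi => ?_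
  rw [← Finset.mul_sum, h.sum_coeff_mul φ (Finset.mem_range.1 hi), sq]

/-- Reflection changes the sign of the overlap when the two symmetry types are opposite. -/
theorem coeff_eq_zero (h : IsPathEigenbasis N w X ev) {q σ : ℝ} (hσ : σ ^ 2 = 1) {k : Fin (N + 2)}
    (hk : X k (N + 1) ≠ σ * X k 0) :
    ∑ j ∈ Finset.range (N + 2), endMode N q σ j * X k j = 0 := by
  have hk1 : ∑ j ∈ Finset.range (N + 2), X k j * X k j = 1 := by simp [h.orthonormal k k]
  have hk0 := (h.eigen k).zero_ne hk1
  have hl : X k (N + 1) = -(σ * X k 0) := by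
    rcases (h.eigen k).last_eq with h1 | h1 <;>
    rcases sq_eq_sq_iff_eq_or_eq_neg.1 (hσ.trans (one_pow 2).symm) with h2 | h2 <;> simp_all
  have hr := Finset.sum_range_reflect (fun j => endMode N q σ j * X k j) (N + 2)
  have e : ∀ j ∈ Finset.range (N + 2),
      endMode N q σ (N + 2 - 1 - j) * X k (N + 2 - 1 - j) = -(endMode N q σ j * X k j) := by
    intro j hj
    have hj : j ≤ N + 1 := by have := Finset.mem_range.1 hj; omega
    have h1 := (h.eigen k).reflect_proportional j hj
    rw [hl] at h1
    have h2 : X k (N + 1 - j) = -σ * X k j := mul_left_cancel₀ hk0 (by linarith)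
    rw [show N + 2 - 1 - j = N + 1 - j by omega, h2, endMode, endMode,
      show N + 1 - (N + 1 - j) = j by omega]
    linear_combination (-q ^ j * X k j) * hσ
  rw [Finset.sum_congr rfl e, Finset.sum_neg_distrib] at hr
  linarith

/-- The symmetric form is evaluated between trial vector and eigenvector in two ways, using either
eigenvalue equation. -/
theorem sub_mul_coeff (h : IsPathEigenbasis N w X ev) (hw : w ≠ 0) {σ : ℝ} (hσ : σ ^ 2 = 1)
    {k : Fin (N + 2)} (hk : X k (N + 1) = σ * X k 0) :
    (ev k - (w + w⁻¹)) * ∑ j ∈ Finset.range (N + 2), endMode N w⁻¹ σ j * X k j =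
      2 * (σ * (w⁻¹ ^ N - w⁻¹ ^ (N + 2))) * X k 0 := by
  have h1 := (h.eigen k).pathForm_eq (endMode N w⁻¹ σ)
  rw [pathForm_comm, (isApproxEigenseq_endMode N hw hσ).pathForm_eq, hk] at h1
  simp only [mul_comm (X k _) (endMode _ _ _ _)] at h1
  linear_combination -h1 + (σ * (w⁻¹ ^ N - w⁻¹ ^ (N + 2))) * X k 0 * hσ

theorem norm_sq (h : IsPathEigenbasis N w X ev) (k : Fin (N + 2)) :
    ∑ j ∈ Finset.range (N + 2), X k j * X k j = 1 := by simp [h.orthonormal k k]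

/-- The factor `|X k 0|` is kept because its squares sum to `1` over `k`: total overlaps are then
bounded without a factor `N`. -/
theorem abs_coeff_le (h : IsPathEigenbasis N w X ev) (hw : 1 < w) {σ : ℝ} (hσ : σ ^ 2 = 1)
    {k : Fin (N + 2)} {d : ℝ} (hd : 0 < d)
    (hk : X k (N + 1) = σ * X k 0 → ev k + d ≤ w + w⁻¹) :
    |∑ j ∈ Finset.range (N + 2), endMode N w⁻¹ σ j * X k j| ≤ 2 * w⁻¹ ^ N / d * |X k 0| := by
  have hq0 : 0 < w⁻¹ := by positivity
  have hq1 : w⁻¹ < 1 := inv_lt_one_of_one_lt₀ hw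
  by_cases hs : X k (N + 1) = σ * X k 0
  · have h1 := congrArg abs (h.sub_mul_coeff (by positivity) hσ hs)
    have hσ1 : |σ| = 1 := by
      rw [← pow_eq_one_iff_of_nonneg (abs_nonneg σ) two_ne_zero, sq_abs, hσ]
    have h2 : |w⁻¹ ^ N - w⁻¹ ^ (N + 2)| ≤ w⁻¹ ^ N := by
      rw [abs_le]
      have := pow_le_pow_of_le_one hq0.le hq1.le (show N ≤ N + 2 by omega)
      have h3 : 0 < w⁻¹ ^ (N + 2) := by positivity
      have h4 : 0 < w⁻¹ ^ N := by positivity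
      constructor <;> linarith
    rw [abs_mul, abs_mul, abs_mul, abs_mul, hσ1, abs_two, one_mul] at h1
    have h3 : d ≤ |ev k - (w + w⁻¹)| := by
      rw [abs_sub_comm]
      exact le_trans (by linarith [hk hs]) (le_abs_self _)
    rw [div_mul_eq_mul_div, le_div_iff₀ hd]
    calc _ ≤ |∑ j ∈ Finset.range (N + 2), endMode N w⁻¹ σ j * X k j| * |ev k - (w + w⁻¹)| := by
          gcongr
      _ = 2 * |w⁻¹ ^ N - w⁻¹ ^ (N + 2)| * |X k 0| := by rw [mul_comm, h1]
      _ ≤ _ := by gcongr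
  · rw [h.coeff_eq_zero hσ hs, abs_zero]
    positivity

/-- In each symmetry class there is an eigenvalue close to `w + 1 / w`. -/
theorem exists_large_eigenvalue (h : IsPathEigenbasis N w X ev) (hw : 1 < w) {σ : ℝ} (hσ : σ ^ 2 = 1)
    {δ κ : ℝ} (hδ : δ = w + w⁻¹ - 2) (hδ0 : 0 < δ) (hκ1 : κ ≤ 1 / 8) (hκδ : κ ≤ δ / 8)
    (hκ : ((N : ℝ) + 2) * w⁻¹ ^ N ≤ κ) :
    ∃ k₀, X k₀ (N + 1) = σ * X k₀ 0 ∧ 2 + δ / 2 < ev k₀ := by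
  have hq0 : 0 < w⁻¹ := by positivity
  have hq1 : w⁻¹ < 1 := inv_lt_one_of_one_lt₀ hw
  set q := w⁻¹ with hq
  have hqN : 0 < q ^ N := by positivity
  have hqκ : q ^ N ≤ κ := by
    have : (0 : ℝ) ≤ N := by positivity
    nlinarith
  set c : Fin (N + 2) → ℝ := fun k => ∑ j ∈ Finset.range (N + 2), endMode N q σ j * X k j with hc
  set S := ∑ j ∈ Finset.range (N + 2), endMode N q σ j ^ 2 with hS
  have hparseval : ∑ k, c k ^ 2 = S := h.sum_coeff_sq _
  have hX0 : ∑ k, X k 0 ^ 2 = 1 := by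
    have := h.complete 0 (by omega) 0 (by omega)
    simpa [sq] using this
  have hSm := abs_sum_sq_endMode_sub_two_le hq0 hq1 hσ hκ
  have hS1 : 1 ≤ S := by
    have hS0 : 0 ≤ S := Finset.sum_nonneg fun _ _ => sq_nonneg _
    have := (abs_le.1 hSm).1
    nlinarith [mul_nonneg (sq_nonneg q) hS0]
  -- Otherwise every eigenvalue of the class is at distance at least `δ / 2` from `w + w⁻¹`, all
  -- overlaps are at most `|X k 0| / 2`, and Parseval gives `S ≤ 1 / 4`.
  by_contra! hcon
  have hle : ∀ k, c k ^ 2 ≤ 1 / 4 * X k 0 ^ 2 := by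
    intro k
    have h1 := h.abs_coeff_le hw hσ (k := k) (half_pos hδ0) fun hs => by
      have := hcon k hs
      rw [hδ] at this ⊢
      linarith
    have h2 : 2 * q ^ N / (δ / 2) ≤ 1 / 2 := by
      rw [div_le_iff₀ (half_pos hδ0)]; linarith
    have h3 : |c k| ≤ 1 / 2 * |X k 0| :=
      h1.trans (mul_le_mul_of_nonneg_right h2 (abs_nonneg _))
    have := pow_le_pow_left₀ (abs_nonneg _) h3 2
    rw [mul_pow, sq_abs, sq_abs] at this
    linarith
  have := Finset.sum_le_sum fun k (_ : k ∈ Finset.univ) => hle k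
  rw [hparseval, ← Finset.mul_sum, hX0] at this
  linarith

/-- In each symmetry class there is exactly one eigenvalue above `2`, and the weight of its
eigenvector at the end vertices is close to `1 - 1 / w ^ 2`. -/
theorem exists_top (h : IsPathEigenbasis N w X ev) (hw : 1 < w) {σ : ℝ} (hσ : σ ^ 2 = 1)
    {δ κ ε : ℝ} (hδ : δ = w + w⁻¹ - 2) (hκ1 : κ ≤ 1 / 8) (hκδ : κ ≤ δ / 8)
    (hκε : 7 * κ * (1 + 1 / δ) ≤ ε) (hκ : ((N : ℝ) + 2) * w⁻¹ ^ N ≤ κ) :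
    ∃ k₀, X k₀ (N + 1) = σ * X k₀ 0 ∧ 2 + δ / 2 < ev k₀ ∧
      |2 * X k₀ 0 ^ 2 - (1 - w⁻¹ ^ 2)| ≤ ε ∧
      ∀ k ≠ k₀, X k (N + 1) = σ * X k 0 → |ev k| ≤ 2 := by
  have hq0 : 0 < w⁻¹ := by positivity
  have hq1 : w⁻¹ < 1 := inv_lt_one_of_one_lt₀ hw
  have hwq : w * w⁻¹ = 1 := mul_inv_cancel₀ (by positivity)
  set q := w⁻¹ with hq
  have hδ0 : 0 < δ := by
    rw [hδ]
    nlinarith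
  have hqN : 0 < q ^ N := by positivity
  have hqκ : q ^ N ≤ κ := by
    have : (0 : ℝ) ≤ N := by positivity
    nlinarith
  have hκ0 : 0 < κ := hqN.trans_le hqκ
  set c : Fin (N + 2) → ℝ := fun k => ∑ j ∈ Finset.range (N + 2), endMode N q σ j * X k j with hc
  set S := ∑ j ∈ Finset.range (N + 2), endMode N q σ j ^ 2 with hS
  have hparseval : ∑ k, c k ^ 2 = S := h.sum_coeff_sq _
  have hX0 : ∑ k, X k 0 ^ 2 = 1 := by
    have := h.complete 0 (by omega) 0 (by omega)
    simpa [sq] using this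
  have hσ1 : |σ| = 1 := by
    rw [← pow_eq_one_iff_of_nonneg (abs_nonneg σ) two_ne_zero, sq_abs, hσ]
  have hq2 : 0 < 1 - q ^ 2 := by nlinarith
  have hSm := abs_sum_sq_endMode_sub_two_le hq0 hq1 hσ hκ
  obtain ⟨k₀, hk₀, hev⟩ := h.exists_large_eigenvalue hw hσ hδ hδ0 hκ1 hκδ hκ
  have hoth : ∀ k ≠ k₀, X k (N + 1) = σ * X k 0 → ev k ≤ 2 := fun k hk hs =>
    (h.eigen k₀).le_two_of_orthonormal (h.eigen k) (h.norm_sq k₀) (h.norm_sq k)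
      (by simp [h.orthonormal, hk.symm]) hk₀ hs (by linarith)
  refine ⟨k₀, hk₀, hev, ?_, fun k hk hs => abs_le.2
    ⟨(h.eigen k).neg_two_le (by positivity) (h.norm_sq k), hoth k hk hs⟩⟩
  have hck : ∀ k ≠ k₀, |c k| ≤ 2 * κ / δ * |X k 0| := by
    intro k hk
    refine (h.abs_coeff_le hw hσ (k := k) hδ0 fun hs => ?_).trans ?_
    · have := hoth k hk hs
      rw [hδ]
      linarith
    · gcongr
  set e := 2 * κ / δ with he
  have he0 : 0 < e := by positivity
  have he1 : e ≤ 1 / 4 := by rw [he, div_le_iff₀ hδ0]; linarith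
  have hrest : ∑ k ∈ Finset.univ.erase k₀, X k 0 ^ 2 ≤ 1 := by
    rw [← hX0]
    exact Finset.sum_le_sum_of_subset_of_nonneg (Finset.erase_subset _ _) fun _ _ _ => sq_nonneg _
  -- Parseval: all overlaps but the top one together carry at most `e ^ 2`.
  have hA : |c k₀ ^ 2 - S| ≤ e ^ 2 := by
    rw [← hparseval, ← Finset.add_sum_erase _ _ (Finset.mem_univ k₀), sub_add_cancel_left, abs_neg,
      abs_of_nonneg (Finset.sum_nonneg fun _ _ => sq_nonneg _)]
    calc _ ≤ ∑ k ∈ Finset.univ.erase k₀, e ^ 2 * X k 0 ^ 2 := by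
          refine Finset.sum_le_sum fun k hk => ?_
          have := pow_le_pow_left₀ (abs_nonneg _) (hck k (Finset.ne_of_mem_erase hk)) 2
          rwa [mul_pow, sq_abs, sq_abs] at this
      _ ≤ e ^ 2 * 1 := by
          rw [← Finset.mul_sum]
          gcongr
      _ = e ^ 2 := mul_one _
  -- The trial vector takes the value `1 + σ * q ^ (N + 1)` at the first vertex; expand it there in
  -- the eigenbasis.
  have hB : |c k₀ * X k₀ 0 - 1| ≤ κ + e := by
    have h1 := h.sum_coeff_mul (endMode N q σ) (i := 0) (by omega)
    rw [← Finset.add_sum_erase _ _ (Finset.mem_univ k₀)] at h1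
    have h2 : |∑ k ∈ Finset.univ.erase k₀, c k * X k 0| ≤ e := by
      calc _ ≤ ∑ k ∈ Finset.univ.erase k₀, e * X k 0 ^ 2 := by
            refine (Finset.abs_sum_le_sum_abs _ _).trans (Finset.sum_le_sum fun k hk => ?_)
            rw [abs_mul, ← sq_abs (X k 0), sq, ← mul_assoc]
            exact mul_le_mul_of_nonneg_right (hck k (Finset.ne_of_mem_erase hk)) (abs_nonneg _)
        _ ≤ e * 1 := by
            rw [← Finset.mul_sum]
            gcongr
        _ = e := mul_one _
    have h3 : |σ * q ^ (N + 1)| ≤ κ := by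
      rw [abs_mul, hσ1, one_mul, abs_of_pos (by positivity)]
      exact (pow_le_pow_of_le_one hq0.le hq1.le (show N ≤ N + 1 by omega)).trans hqκ
    have h4 : c k₀ * X k₀ 0 - 1 = σ * q ^ (N + 1) - ∑ k ∈ Finset.univ.erase k₀, c k * X k 0 := by
      have : endMode N q σ 0 = 1 + σ * q ^ (N + 1) := by simp [endMode]
      rw [this] at h1
      linarith
    rw [h4]
    exact (abs_sub _ _).trans (add_le_add h3 h2)
  have hv1 : X k₀ 0 ^ 2 ≤ 1 := by
    rw [← hX0]
    exact Finset.single_le_sum (f := fun k => X k 0 ^ 2) (fun _ _ => sq_nonneg _)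
      (Finset.mem_univ k₀)
  refine le_trans ?_ hκε
  have h7 : 7 * κ * (1 + 1 / δ) = 7 * κ + 7 / 2 * e := by rw [he]; field_simp
  rw [h7]
  exact abs_two_mul_sq_sub_le hq2 (by linarith [sq_nonneg q]) hκ0 hκ1 he0 he1 hv1 hSm hA hB

end IsPathEigenbasis

/-- The weight is `2 * X k 0 ^ 2` for eigenvectors of class `σ` and `0` for the others, so nonzero
weight selects the class. -/
theorem eventually_spectral_estimates {w ε : ℝ} (hw : 1 < w) (hε : 0 < ε) :
    ∀ᶠ N : ℕ in atTop, ∀ X ev, IsPathEigenbasis N w X ev → ∀ σ : ℝ, σ ^ 2 = 1 →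
      ∃ k₀, |X k₀ 0 * (X k₀ 0 + σ * X k₀ (N + 1)) - (1 - w⁻¹ ^ 2)| ≤ ε ∧
        (∀ k ≠ k₀, X k 0 * (X k 0 + σ * X k (N + 1)) ≤ ε) ∧
        ∀ k l, k ≠ l → X k 0 * (X k 0 + σ * X k (N + 1)) ≠ 0 →
          X l 0 * (X l 0 + σ * X l (N + 1)) ≠ 0 → 1 / ((N : ℝ) + 2) ^ 2 ≤ |ev k - ev l| := by
  have hq0 : 0 < w⁻¹ := by positivity
  have hq1 : w⁻¹ < 1 := inv_lt_one_of_one_lt₀ hw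
  have hwq : w * w⁻¹ = 1 := mul_inv_cancel₀ (by positivity)
  -- The height of the localized level above the band edge `2`, equal to `(w - 1) ^ 2 / w`.
  set δ := w + w⁻¹ - 2 with hδ
  have hδ0 : 0 < δ := by
    rw [hδ]
    nlinarith
  obtain ⟨κ, hκ0, hκ1, hκδ, hκε⟩ : ∃ κ : ℝ, 0 < κ ∧ κ ≤ 1 / 8 ∧ κ ≤ δ / 8 ∧
      7 * κ * (1 + 1 / δ) ≤ ε := by
    refine ⟨min (min (1 / 8) (δ / 8)) (ε / (7 * (1 + 1 / δ))), by positivity,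
      (min_le_left _ _).trans (min_le_left _ _), (min_le_left _ _).trans (min_le_right _ _), ?_⟩
    have h := min_le_right (min (1 / 8) (δ / 8)) (ε / (7 * (1 + 1 / δ)))
    rw [le_div_iff₀ (by positivity)] at h
    linarith
  have hgeom : ∀ᶠ N : ℕ in atTop, ((N : ℝ) + 2) * w⁻¹ ^ N ≤ κ := by
    have h1 := tendsto_self_mul_const_pow_of_lt_one hq0.le hq1
    have h2 := (tendsto_pow_atTop_nhds_zero_of_lt_one hq0.le hq1).const_mul 2
    have h3 := h1.add h2
    rw [mul_zero, add_zero] at h3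
    filter_upwards [h3.eventually (ge_mem_nhds hκ0)] with N hN
    linarith
  have hbulk : ∀ᶠ N : ℕ in atTop, 2 * (4 / (((N : ℝ) + 1) * (w - 1) ^ 2)) ≤ ε := by
    have h1 := (tendsto_one_div_add_atTop_nhds_zero_nat (𝕜 := ℝ)).mul_const (8 / (w - 1) ^ 2)
    rw [zero_mul] at h1
    filter_upwards [h1.eventually (ge_mem_nhds hε)] with N hN
    refine le_of_eq_of_le ?_ hN
    have : (w - 1) ≠ 0 := by linarith
    field_simp
    norm_num
  have hgap : ∀ᶠ N : ℕ in atTop, 1 / ((N : ℝ) + 2) ^ 2 ≤ δ / 2 := by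
    have h1 := tendsto_one_div_add_atTop_nhds_zero_nat (𝕜 := ℝ)
    filter_upwards [h1.eventually (ge_mem_nhds (half_pos hδ0))] with N hN
    refine le_trans ?_ hN
    have : (0 : ℝ) ≤ N := by positivity
    exact one_div_le_one_div_of_le (by positivity) (by nlinarith)
  filter_upwards [hgeom, hbulk, hgap] with N hN hNb hNg X ev h σ hσ
  obtain ⟨k₀, hk₀, hev, hwt, hoth⟩ := h.exists_top hw hσ hδ hκ1 hκδ hκε hN
  have hsec : ∀ k, X k (N + 1) = σ * X k 0 →
      X k 0 * (X k 0 + σ * X k (N + 1)) = 2 * X k 0 ^ 2 := by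
    intro k hk
    rw [hk]
    linear_combination X k 0 ^ 2 * hσ
  have hnsec : ∀ k, X k (N + 1) ≠ σ * X k 0 → X k 0 * (X k 0 + σ * X k (N + 1)) = 0 := by
    intro k hk
    rcases (h.eigen k).last_eq with h1 | h1 <;>
    rcases sq_eq_sq_iff_eq_or_eq_neg.1 (hσ.trans (one_pow 2).symm) with h2 | h2 <;> simp_all
  refine ⟨k₀, ?_, fun k hk => ?_, fun k l hkl hk hl => ?_⟩
  · rwa [hsec k₀ hk₀]
  · by_cases hs : X k (N + 1) = σ * X k 0
    · rw [hsec k hs]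
      have := (h.eigen k).sq_zero_le hw (hoth k hk hs) (h.norm_sq k)
      linarith
    · rw [hnsec k hs]
      exact hε.le
  · have hk' := not_imp_comm.1 (hnsec k) hk
    have hl' := not_imp_comm.1 (hnsec l) hl
    by_cases hk0 : k = k₀
    · subst hk0
      have := (abs_le.1 (hoth l hkl.symm hl')).2
      exact (hNg.trans (by linarith)).trans (le_abs_self _)
    · by_cases hl0 : l = k₀
      · subst hl0
        have := (abs_le.1 (hoth k hk0 hk')).2
        rw [abs_sub_comm]
        exact (hNg.trans (by linarith)).trans (le_abs_self _)
      · exact (h.eigen k).inv_sq_le_abs_sub (h.eigen l) (h.norm_sq k) (h.norm_sq l)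
          (by simp [h.orthonormal, hkl]) (hoth k hk0 hk') (hoth l hl0 hl')

/-! ### Convolution squares of exponential sums -/

section Oscillation

variable {ι : Type*} [Fintype ι]

/-- The Fourier transform of the finite measure with mass `μ k` at `ev k`. -/
noncomputable def charSum (μ ev : ι → ℝ) (t : ℝ) : ℂ :=
  ∑ k, (μ k : ℂ) * Complex.exp (((t * ev k : ℝ) : ℂ) * Complex.I)

theorem continuous_charSum (μ ev : ι → ℝ) : Continuous (charSum μ ev) := by
  unfold charSum
  fun_prop

theorem norm_charSum_le {μ ev : ι → ℝ} (h0 : ∀ k, 0 ≤ μ k) (h1 : ∑ k, μ k = 1) (t : ℝ) :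
    ‖charSum μ ev t‖ ≤ 1 := by
  rw [← h1]
  refine norm_sum_le_of_le _ fun k _ => ?_
  rw [norm_mul, Complex.norm_exp_ofReal_mul_I, mul_one, Complex.norm_real, Real.norm_eq_abs,
    abs_of_nonneg (h0 k)]

theorem norm_charSum_sub_le {μ ev : ι → ℝ} (h0 : ∀ k, 0 ≤ μ k) (h1 : ∑ k, μ k = 1) (t : ℝ)
    (k₀ : ι) :
    ‖charSum μ ev t - μ k₀ * Complex.exp (((t * ev k₀ : ℝ) : ℂ) * Complex.I)‖ ≤ 1 - μ k₀ := by
  classical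
  rw [charSum, ← Finset.add_sum_erase _ _ (Finset.mem_univ k₀), add_sub_cancel_left, ← h1,
    ← Finset.add_sum_erase _ _ (Finset.mem_univ k₀), add_sub_cancel_left]
  refine norm_sum_le_of_le _ fun k _ => ?_
  rw [norm_mul, Complex.norm_exp_ofReal_mul_I, mul_one, Complex.norm_real, Real.norm_eq_abs,
    abs_of_nonneg (h0 k)]

/-- The convolution of two exponentials. -/
noncomputable def expConv (a b t : ℝ) : ℂ :=
  ∫ s in (0 : ℝ)..t, Complex.exp ((((t - s) * a : ℝ) : ℂ) * Complex.I) *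
    Complex.exp (((s * b : ℝ) : ℂ) * Complex.I)

theorem expConv_self (a t : ℝ) :
    expConv a a t = t * Complex.exp (((t * a : ℝ) : ℂ) * Complex.I) := by
  have : ∀ s : ℝ, Complex.exp ((((t - s) * a : ℝ) : ℂ) * Complex.I) *
      Complex.exp (((s * a : ℝ) : ℂ) * Complex.I) =
      Complex.exp (((t * a : ℝ) : ℂ) * Complex.I) := by
    intro s
    rw [← Complex.exp_add]
    congr 1
    push_cast
    ring
  simp only [expConv, this, intervalIntegral.integral_const, sub_zero, Complex.real_smul]

/-- Up to a unimodular constant the integrand is `exp (i (b - a) s)`, whose primitive is bounded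
uniformly in `t`. -/
theorem norm_expConv_le {a b t γ : ℝ} (hγ : 0 < γ) (hab : γ ≤ |a - b|) :
    ‖expConv a b t‖ ≤ 2 / γ := by
  have hne : a - b ≠ 0 := by
    intro h
    rw [h, abs_zero] at hab
    linarith
  have hc : ((b - a : ℝ) : ℂ) * Complex.I ≠ 0 :=
    mul_ne_zero (by exact_mod_cast (by intro h; apply hne; linarith)) Complex.I_ne_zero
  have : ∀ s : ℝ, Complex.exp ((((t - s) * a : ℝ) : ℂ) * Complex.I) *
      Complex.exp (((s * b : ℝ) : ℂ) * Complex.I) =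
      Complex.exp (((t * a : ℝ) : ℂ) * Complex.I) *
        Complex.exp ((((b - a : ℝ) : ℂ) * Complex.I) * s) := by
    intro s
    rw [← Complex.exp_add, ← Complex.exp_add]
    congr 1
    push_cast
    ring
  simp only [expConv, this]
  rw [intervalIntegral.integral_const_mul, integral_exp_mul_complex hc, norm_mul,
    Complex.norm_exp_ofReal_mul_I, one_mul, norm_div, norm_mul, Complex.norm_I, mul_one,
    Complex.norm_real, Real.norm_eq_abs, abs_sub_comm]
  refine div_le_div₀ zero_le_two ?_ hγ hab
  refine (norm_sub_le _ _).trans ?_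
  have h1 : ∀ x : ℝ, ‖Complex.exp (((b - a : ℝ) : ℂ) * Complex.I * x)‖ = 1 := by
    intro x
    rw [← Complex.norm_exp_ofReal_mul_I ((b - a) * x)]
    congr 2
    push_cast
    ring
  rw [h1, h1]
  norm_num

theorem integral_charSum_mul (μ ev : ι → ℝ) (t : ℝ) :
    ∫ s in (0 : ℝ)..t, charSum μ ev (t - s) * charSum μ ev s =
      ∑ k, ∑ l, ((μ k * μ l : ℝ) : ℂ) * expConv (ev k) (ev l) t := by
  simp only [charSum, Finset.sum_mul_sum]
  rw [intervalIntegral.integral_finsetSum]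
  · refine Finset.sum_congr rfl fun k _ => ?_
    rw [intervalIntegral.integral_finsetSum]
    · refine Finset.sum_congr rfl fun l _ => ?_
      rw [expConv, ← intervalIntegral.integral_const_mul]
      congr 1
      ext s
      push_cast
      ring
    · exact fun l _ => Continuous.intervalIntegrable (by fun_prop) _ _
  · exact fun k _ => Continuous.intervalIntegrable (by fun_prop) _ _

/-- If all point masses but one are small and the support is separated, then the convolution
square of the Fourier transform is dominated by the contribution of the large mass. -/
theorem norm_integral_charSum_mul_sub_le {μ ev : ι → ℝ} (h0 : ∀ k, 0 ≤ μ k) (h1 : ∑ k, μ k = 1)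
    {t ε γ : ℝ} (ht : 0 ≤ t) (hγ : 0 < γ) (k₀ : ι) (hε : ∀ k ≠ k₀, μ k ≤ ε)
    (hgap : ∀ k l, k ≠ l → μ k ≠ 0 → μ l ≠ 0 → γ ≤ |ev k - ev l|) (hε0 : 0 ≤ ε) :
    ‖(∫ s in (0 : ℝ)..t, charSum μ ev (t - s) * charSum μ ev s) -
        t * (μ k₀ : ℂ) ^ 2 * Complex.exp (((t * ev k₀ : ℝ) : ℂ) * Complex.I)‖ ≤
      t * ε + 2 / γ := by
  classical
  have e : (t : ℂ) * (μ k₀ : ℂ) ^ 2 * Complex.exp (((t * ev k₀ : ℝ) : ℂ) * Complex.I) =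
      ∑ k, ∑ l, if k = k₀ then if l = k₀ then
        ((μ k * μ l : ℝ) : ℂ) * expConv (ev k) (ev l) t else 0 else 0 := by
    simp only [Finset.sum_ite_eq', Finset.sum_ite_irrel, Finset.mem_univ, if_true,
      Finset.sum_const_zero, expConv_self]
    push_cast
    ring
  rw [integral_charSum_mul, e, ← Finset.sum_sub_distrib]
  simp only [← Finset.sum_sub_distrib]
  -- Distinct frequencies cost `2 / γ` and a small diagonal atom costs `t * ε * μ k`; both bounds
  -- sum by total mass `1`.
  have hterm : ∀ k l, ‖((μ k * μ l : ℝ) : ℂ) * expConv (ev k) (ev l) t -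
      (if k = k₀ then if l = k₀ then
        ((μ k * μ l : ℝ) : ℂ) * expConv (ev k) (ev l) t else 0 else 0)‖ ≤
      μ k * μ l * (2 / γ) + if k = l then t * ε * μ k else 0 := by
    intro k l
    have hkl0 : 0 ≤ μ k * μ l * (2 / γ) := by
      have := mul_nonneg (h0 k) (h0 l)
      positivity
    by_cases hkl : k = l
    · subst hkl
      have hpos : 0 ≤ t * ε * μ k := mul_nonneg (mul_nonneg ht hε0) (h0 k)
      by_cases hk : k = k₀
      · simp only [hk, if_true, sub_self, norm_zero]
        rw [hk] at hkl0 hpos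
        linarith
      · rw [if_neg hk, sub_zero, expConv_self, if_pos rfl, norm_mul, norm_mul,
          Complex.norm_exp_ofReal_mul_I, mul_one, Complex.norm_real, Complex.norm_real,
          Real.norm_eq_abs, Real.norm_eq_abs, abs_of_nonneg ht,
          abs_of_nonneg (mul_nonneg (h0 k) (h0 k))]
        have := mul_le_mul_of_nonneg_left (hε k hk) (mul_nonneg ht (h0 k))
        linarith
    · have h2 : (if k = k₀ then if l = k₀ then
          ((μ k * μ l : ℝ) : ℂ) * expConv (ev k) (ev l) t else 0 else 0) = 0 := by
        by_cases hk : k = k₀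
        · rw [if_pos hk, if_neg (fun hl => hkl (hk.trans hl.symm))]
        · rw [if_neg hk]
      rw [h2, sub_zero, if_neg hkl, add_zero, norm_mul, Complex.norm_real, Real.norm_eq_abs,
        abs_of_nonneg (mul_nonneg (h0 k) (h0 l))]
      by_cases hk : μ k = 0
      · simp [hk]
      by_cases hl : μ l = 0
      · simp [hl]
      exact mul_le_mul_of_nonneg_left (norm_expConv_le hγ (hgap k l hkl hk hl))
        (mul_nonneg (h0 k) (h0 l))
  refine (norm_sum_le_of_le _ fun k _ => norm_sum_le_of_le _ fun l _ => hterm k l).trans ?_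
  simp only [Finset.sum_add_distrib, Finset.sum_ite_eq, Finset.mem_univ, if_true,
    ← Finset.sum_mul, ← Finset.mul_sum, h1]
  linarith

end Oscillation

/-! ### The cancellation in the derivative of the squared modulus -/

/-- The real inner product of `U` with a vector close to `i t m L`, where `L` is close to `U`. -/
theorem abs_inner_le_of_two_level {S T D G x y : ℂ} {m m₁ m₂ t ε R : ℝ} (ht : 0 ≤ t)
    (hm0 : 0 ≤ m) (hm1 : m ≤ 1) (hS1 : ‖S‖ ≤ 1) (hT1 : ‖T‖ ≤ 1) (hx : ‖x‖ = 1) (hy : ‖y‖ = 1)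
    (hS : ‖S - m₁ * x‖ ≤ 1 - m₁) (hT : ‖T - m₂ * y‖ ≤ 1 - m₂)
    (hD : ‖D - t * (m₁ : ℂ) ^ 2 * x‖ ≤ R) (hG : ‖G - t * (m₂ : ℂ) ^ 2 * y‖ ≤ R)
    (h₁ : |m₁ - m| ≤ ε) (h₂ : |m₂ - m| ≤ ε) (hm₁ : 0 ≤ m₁) (hm₂ : 0 ≤ m₂) :
    |inner ℝ ((S - T) / 2) (Complex.I * (D - G) / 2)| ≤
      t * (m ^ 2 * (1 - m)) + 4 * t * ε + R := by
  have hm₁1 : m₁ ≤ 1 := by linarith [norm_nonneg (S - m₁ * x)]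
  have hm₂1 : m₂ ≤ 1 := by linarith [norm_nonneg (T - m₂ * y)]
  set L : ℂ := m * (x - y) / 2 with hL
  set U : ℂ := (S - T) / 2 with hU
  have n2 : ‖(2 : ℂ)‖ = 2 := by simp
  have nR : ∀ r : ℝ, ‖(r : ℂ)‖ = |r| := fun r => by rw [Complex.norm_real, Real.norm_eq_abs]
  have hUn : ‖U‖ ≤ 1 := by
    rw [hU, norm_div, n2]
    linarith [norm_sub_le S T]
  have hLn : ‖L‖ ≤ m := by
    rw [hL, norm_div, norm_mul, n2, nR, abs_of_nonneg hm0]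
    nlinarith [norm_sub_le x y]
  -- One `ε` comes from replacing `m₁` and `m₂` by `m` in the atoms, the other from the discarded
  -- masses `1 - m₁` and `1 - m₂`.
  have hUL : ‖U - L‖ ≤ 1 - m + 2 * ε := by
    have e : U - L = ((S - m₁ * x) + ((m₁ - m : ℝ) : ℂ) * x -
        ((T - m₂ * y) + ((m₂ - m : ℝ) : ℂ) * y)) / 2 := by
      rw [hU, hL]; push_cast; ring
    have a1 : ‖((m₁ - m : ℝ) : ℂ) * x‖ ≤ ε := by rwa [norm_mul, hx, mul_one, nR]
    have a2 : ‖((m₂ - m : ℝ) : ℂ) * y‖ ≤ ε := by rwa [norm_mul, hy, mul_one, nR]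
    rw [e, norm_div, n2]
    have b1 := norm_sub_le ((S - m₁ * x) + ((m₁ - m : ℝ) : ℂ) * x)
      ((T - m₂ * y) + ((m₂ - m : ℝ) : ℂ) * y)
    have b2 := norm_add_le (S - m₁ * x) (((m₁ - m : ℝ) : ℂ) * x)
    have b3 := norm_add_le (T - m₂ * y) (((m₂ - m : ℝ) : ℂ) * y)
    linarith [(abs_le.1 h₁).1, (abs_le.1 h₂).1]
  have hsq : ∀ r : ℝ, 0 ≤ r → r ≤ 1 → |r - m| ≤ ε → |t * (r ^ 2 - m ^ 2)| ≤ t * (2 * ε) := by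
    intro r hr0 hr1 hr
    rw [abs_mul, abs_of_nonneg ht, show r ^ 2 - m ^ 2 = (r + m) * (r - m) by ring, abs_mul,
      abs_of_nonneg (add_nonneg hr0 hm0)]
    exact mul_le_mul_of_nonneg_left
      (mul_le_mul (by linarith) hr (abs_nonneg _) zero_le_two) ht
  set V : ℂ := Complex.I * (D - G) / 2 - Complex.I * (((t * m : ℝ) : ℂ) * L) with hV
  have hVn : ‖V‖ ≤ R + 2 * t * ε := by
    have e : V = Complex.I * ((D - t * (m₁ : ℂ) ^ 2 * x) + ((t * (m₁ ^ 2 - m ^ 2) : ℝ) : ℂ) * x -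
        ((G - t * (m₂ : ℂ) ^ 2 * y) + ((t * (m₂ ^ 2 - m ^ 2) : ℝ) : ℂ) * y)) / 2 := by
      rw [hV, hL]; push_cast; ring
    have a1 : ‖((t * (m₁ ^ 2 - m ^ 2) : ℝ) : ℂ) * x‖ ≤ t * (2 * ε) := by
      rw [norm_mul, hx, mul_one, nR]; exact hsq m₁ hm₁ hm₁1 h₁
    have a2 : ‖((t * (m₂ ^ 2 - m ^ 2) : ℝ) : ℂ) * y‖ ≤ t * (2 * ε) := by
      rw [norm_mul, hy, mul_one, nR]; exact hsq m₂ hm₂ hm₂1 h₂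
    rw [e, norm_div, norm_mul, Complex.norm_I, one_mul, n2]
    have b1 := norm_sub_le ((D - t * (m₁ : ℂ) ^ 2 * x) + ((t * (m₁ ^ 2 - m ^ 2) : ℝ) : ℂ) * x)
      ((G - t * (m₂ : ℂ) ^ 2 * y) + ((t * (m₂ ^ 2 - m ^ 2) : ℝ) : ℂ) * y)
    have b2 := norm_add_le (D - t * (m₁ : ℂ) ^ 2 * x) (((t * (m₁ ^ 2 - m ^ 2) : ℝ) : ℂ) * x)
    have b3 := norm_add_le (G - t * (m₂ : ℂ) ^ 2 * y) (((t * (m₂ ^ 2 - m ^ 2) : ℝ) : ℂ) * y)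
    linarith
  -- The decisive cancellation: multiplication by `I` is a rotation by a right angle.
  have hLL : inner ℝ L (Complex.I * (((t * m : ℝ) : ℂ) * L)) = 0 := by
    rw [Complex.inner]
    simp
    ring
  have e : inner ℝ U (Complex.I * (D - G) / 2) =
      inner ℝ (U - L) (Complex.I * (((t * m : ℝ) : ℂ) * L)) + inner ℝ U V := by
    rw [inner_sub_left, hLL, sub_zero, ← inner_add_right, hV, add_sub_cancel]
  rw [e]
  refine (abs_add_le _ _).trans ?_
  have c1 := (abs_real_inner_le_norm (U - L) (Complex.I * (((t * m : ℝ) : ℂ) * L)))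
  have c2 := (abs_real_inner_le_norm U V)
  have htm : 0 ≤ t * m := mul_nonneg ht hm0
  rw [norm_mul, Complex.norm_I, one_mul, norm_mul, nR, abs_of_nonneg htm] at c1
  have hε0 : 0 ≤ ε := (abs_nonneg _).trans h₁
  have d1 : ‖U - L‖ * (t * m * ‖L‖) ≤ (1 - m + 2 * ε) * (t * m * m) :=
    mul_le_mul hUL (mul_le_mul_of_nonneg_left hLn htm) (by positivity) (by linarith)
  have d2 : ‖U‖ * ‖V‖ ≤ R + 2 * t * ε :=
    (mul_le_of_le_one_left (norm_nonneg _) hUn).trans hVn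
  have d3 : 2 * ε * (t * m * m) ≤ 2 * ε * t := by
    have : t * m * m ≤ t := by
      rw [mul_assoc]
      exact mul_le_of_le_one_right ht (mul_le_one₀ hm1 hm0 hm1)
    exact mul_le_mul_of_nonneg_left this (by positivity)
  linarith

/-! ### Splitting the amplitude by symmetry class -/

theorem isSymm_loopedPathMatrix (n : ℕ) (w : ℝ) : (loopedPathMatrix n w).IsSymm := by
  ext i j
  simp only [Matrix.transpose_apply, loopedPathMatrix, Matrix.of_apply]
  by_cases h : i = j
  · rw [h]
  · rw [if_neg h, if_neg (Ne.symm h)]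
    simp only [or_comm]

theorem exists_isPathEigenbasis (N : ℕ) (w : ℝ) :
    ∃ X ev, IsPathEigenbasis N w X ev ∧ ∀ (t : ℝ) (a b : Fin (N + 2)),
      transitionMatrix (loopedPathMatrix (N + 2) w) t a b =
        charSum (fun k => X k a * X k b) ev t := by
  obtain ⟨V, ev, h1, h2, h3, h4⟩ :=
    exists_spectral_decomposition _ (isSymm_loopedPathMatrix (N + 2) w)
  refine ⟨fun k => zeroExtend (V k), ev, ⟨fun k => isEigenseq_zeroExtend (h1 k), fun k l => ?_,
    fun i hi j hj => ?_⟩, fun t a b => ?_⟩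
  · rw [← h2 k l, ← Fin.sum_univ_eq_sum_range (fun j => zeroExtend (V k) j * zeroExtend (V l) j)]
    simp only [zeroExtend_coe]
  · have := h3 ⟨i, hi⟩ ⟨j, hj⟩
    simpa [zeroExtend, hi, hj] using this
  · simp only [h4, charSum, zeroExtend_coe]

/-- Weights of the eigenvectors in the symmetry class `σ`. -/
def endWeight {N : ℕ} (X : Fin (N + 2) → ℕ → ℝ) (σ : ℝ) (k : Fin (N + 2)) : ℝ :=
  X k 0 * (X k 0 + σ * X k (N + 1))

namespace IsPathEigenbasis

variable {N : ℕ} {w : ℝ} {X : Fin (N + 2) → ℕ → ℝ} {ev : Fin (N + 2) → ℝ}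

theorem endWeight_nonneg (h : IsPathEigenbasis N w X ev) {σ : ℝ} (hσ : σ ^ 2 = 1)
    (k : Fin (N + 2)) : 0 ≤ endWeight X σ k := by
  rw [endWeight]
  rcases (h.eigen k).last_eq with h1 | h1 <;>
  rcases sq_eq_sq_iff_eq_or_eq_neg.1 (hσ.trans (one_pow 2).symm) with h2 | h2 <;> rw [h1, h2] <;>
  nlinarith [sq_nonneg (X k 0)]

/-- Completeness at the vertex pairs `(0, 0)` and `(0, N + 1)` gives `1` and `0`. Together with
nonnegativity, each class carries a probability measure. -/
theorem sum_endWeight (h : IsPathEigenbasis N w X ev) (σ : ℝ) : ∑ k, endWeight X σ k = 1 := by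
  have h1 := h.complete 0 (by omega) 0 (by omega)
  have h2 := h.complete 0 (by omega) (N + 1) (by omega)
  have : ∀ k, endWeight X σ k = X k 0 * X k 0 + σ * (X k 0 * X k (N + 1)) := fun k => by
    rw [endWeight]; ring
  simp only [this, Finset.sum_add_distrib, ← Finset.mul_sum, h1, h2]
  simp

theorem charSum_endWeight (σ t : ℝ) :
    charSum (endWeight X σ) ev t = charSum (fun k => X k 0 * X k 0) ev t +
      σ * charSum (fun k => X k 0 * X k (N + 1)) ev t := by
  simp only [charSum, Finset.mul_sum, ← Finset.sum_add_distrib]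
  refine Finset.sum_congr rfl fun k _ => ?_
  rw [endWeight]
  push_cast
  ring

end IsPathEigenbasis

theorem mul_endLoops_mul_apply {N : ℕ} (A B : Matrix (Fin (N + 2)) (Fin (N + 2)) ℂ)
    (a b : Fin (N + 2)) :
    (A * (Complex.I • (endLoops (N + 2)).map Complex.ofReal) * B) a b =
      Complex.I * (A a 0 * B 0 b + A a (Fin.last _) * B (Fin.last _) b) := by
  rw [Matrix.mul_smul, Matrix.smul_mul, Matrix.smul_apply, smul_eq_mul]
  congr 1
  rw [endLoops, Matrix.diagonal_map Complex.ofReal_zero, Matrix.mul_apply]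
  simp only [Matrix.mul_diagonal]
  rw [Fin.sum_univ_succ, Fin.sum_univ_castSucc]
  have : ∀ i : Fin N, ¬ ((i.castSucc.succ : Fin (N + 2)).val = 0 ∨
      (i.castSucc.succ : Fin (N + 2)).val + 1 = N + 2) := by
    intro i
    have := i.isLt
    simp only [Fin.val_succ, Fin.val_castSucc]
    omega
  rw [Finset.sum_eq_zero fun i _ => by rw [if_neg (this i)]; simp]
  simp

/-- The derivative of the end-to-end transition amplitude, in terms of the two symmetry classes. -/
theorem exists_hasDerivAt_amplitude (N : ℕ) (w : ℝ) :
    ∃ X ev, IsPathEigenbasis N w X ev ∧ ∀ t : ℝ,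
      transitionMatrix (loopedPathMatrix (N + 2) w) t 0 (Fin.last _) =
        (charSum (endWeight X 1) ev t - charSum (endWeight X (-1)) ev t) / 2 ∧
      HasDerivAt
        (fun x => transitionMatrix (loopedPathMatrix (N + 2) x) t 0 (Fin.last _))
        (Complex.I *
          ((∫ s in (0 : ℝ)..t, charSum (endWeight X 1) ev (t - s) * charSum (endWeight X 1) ev s) -
          ∫ s in (0 : ℝ)..t,
            charSum (endWeight X (-1)) ev (t - s) * charSum (endWeight X (-1)) ev s) / 2) w := by
  obtain ⟨X, ev, h, hU⟩ := exists_isPathEigenbasis N w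
  refine ⟨X, ev, h, fun t => ⟨?_, ?_⟩⟩
  · rw [hU, IsPathEigenbasis.charSum_endWeight, IsPathEigenbasis.charSum_endWeight]
    push_cast
    simp
  · refine (hasDerivAt_transitionMatrix_apply (N + 2) w t 0 (Fin.last _)).congr_deriv ?_
    have hc : ∀ σ, Continuous fun s =>
        charSum (endWeight X σ) ev (t - s) * charSum (endWeight X σ) ev s := fun σ =>
      ((continuous_charSum _ _).comp (continuous_const.sub continuous_id)).mul
        (continuous_charSum _ _)
    rw [← intervalIntegral.integral_sub ((hc 1).intervalIntegrable _ _)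
      ((hc (-1)).intervalIntegrable _ _), mul_div_right_comm,
      ← intervalIntegral.integral_const_mul]
    congr 1
    ext s
    have hlast : ((Fin.last (N + 1) : Fin (N + 2)) : ℕ) = N + 1 := rfl
    -- By reflection both ends have the same return amplitude `u`. With transfer amplitude `v`, the
    -- classes are `u + v` and `u - v`, and half the difference of their products at `t - s` and `s`
    -- is the Duhamel integrand up to the factor `I`.
    have hll : (fun k => X k (N + 1) * X k (N + 1)) = fun k => X k 0 * X k 0 := by
      ext k
      rcases (h.eigen k).last_eq with h1 | h1 <;> rw [h1]
      ring
    rw [mul_endLoops_mul_apply]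
    simp only [hU, IsPathEigenbasis.charSum_endWeight, hlast, Fin.val_zero, hll]
    push_cast
    ring

theorem norm_integral_charSum_mul_le {ι : Type*} [Fintype ι] {μ ev : ι → ℝ}
    (h0 : ∀ k, 0 ≤ μ k) (h1 : ∑ k, μ k = 1) {t : ℝ} (ht : 0 ≤ t) :
    ‖∫ s in (0 : ℝ)..t, charSum μ ev (t - s) * charSum μ ev s‖ ≤ t := by
  have := intervalIntegral.norm_integral_le_of_norm_le_const (a := (0 : ℝ)) (b := t) (C := 1)
    (f := fun s => charSum μ ev (t - s) * charSum μ ev s) fun s _ => by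
      rw [norm_mul]
      exact mul_le_one₀ (norm_charSum_le h0 h1 _) (norm_nonneg _) (norm_charSum_le h0 h1 _)
  simpa [abs_of_nonneg ht] using this

theorem endFidelity_eq (N : ℕ) (h : 0 < N + 2) (x t : ℝ) :
    endFidelity (N + 2) h x t =
      ‖transitionMatrix (loopedPathMatrix (N + 2) x) t 0 (Fin.last _)‖ ^ 2 := rfl

/-! ### Bounds on the fidelity derivative -/

/-- The bound on the derivative of the fidelity that holds for every length. -/
theorem abs_deriv_endFidelity_le (N : ℕ) (h : 0 < N + 2) (w : ℝ) {t : ℝ} (ht : 0 ≤ t) :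
    DifferentiableAt ℝ (fun x => endFidelity (N + 2) h x t) w ∧
      |deriv (fun x => endFidelity (N + 2) h x t) w| ≤ 2 * t := by
  simp only [endFidelity_eq]
  obtain ⟨X, ev, hX, hU⟩ := exists_hasDerivAt_amplitude N w
  obtain ⟨hU1, hU2⟩ := hU t
  have hd := hU2.norm_sq
  refine ⟨hd.differentiableAt, ?_⟩
  rw [hd.deriv, hU1, abs_mul, abs_two]
  refine mul_le_mul_of_nonneg_left ((abs_real_inner_le_norm _ _).trans ?_) zero_le_two
  have hs : ((-1 : ℝ)) ^ 2 = 1 := by norm_num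
  have a1 := norm_charSum_le (ev := ev) (hX.endWeight_nonneg (one_pow 2)) (hX.sum_endWeight 1) t
  have a2 := norm_charSum_le (ev := ev) (hX.endWeight_nonneg hs) (hX.sum_endWeight (-1)) t
  have b1 := norm_integral_charSum_mul_le (ev := ev) (hX.endWeight_nonneg (one_pow 2))
    (hX.sum_endWeight 1) ht
  have b2 := norm_integral_charSum_mul_le (ev := ev) (hX.endWeight_nonneg hs)
    (hX.sum_endWeight (-1)) ht
  rw [norm_div, norm_div, norm_mul, Complex.norm_I, one_mul, Complex.norm_two]
  refine (mul_le_mul (b := 1) (d := t) ?_ ?_ (div_nonneg (norm_nonneg _) zero_le_two)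
    zero_le_one).trans_eq (one_mul t)
  · linarith [norm_sub_le (charSum (endWeight X 1) ev t) (charSum (endWeight X (-1)) ev t)]
  · have := norm_sub_le
      (∫ s in (0 : ℝ)..t, charSum (endWeight X 1) ev (t - s) * charSum (endWeight X 1) ev s)
      (∫ s in (0 : ℝ)..t, charSum (endWeight X (-1)) ev (t - s) * charSum (endWeight X (-1)) ev s)
    linarith

/-- The bound on the derivative of the fidelity for long paths. -/
theorem eventually_abs_deriv_endFidelity_le {w ε : ℝ} (hw : 1 < w) (hε : 0 < ε) :
    ∀ᶠ N : ℕ in atTop, ∀ (h : 0 < N + 2) (t : ℝ), 0 ≤ t →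
      |deriv (fun x => endFidelity (N + 2) h x t) w| ≤
        2 * (t * ((1 - w⁻¹ ^ 2) ^ 2 * w⁻¹ ^ 2) + 5 * t * ε + 2 * ((N : ℝ) + 2) ^ 2) := by
  filter_upwards [eventually_spectral_estimates hw hε] with N hN h t ht
  simp only [endFidelity_eq]
  obtain ⟨X, ev, hX, hU⟩ := exists_hasDerivAt_amplitude N w
  obtain ⟨hU1, hU2⟩ := hU t
  have hq0 : 0 < w⁻¹ := by positivity
  have hq1 : w⁻¹ < 1 := inv_lt_one_of_one_lt₀ hw
  have hs : ((-1 : ℝ)) ^ 2 = 1 := by norm_num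
  obtain ⟨k, hk, hk2, hk3⟩ := hN X ev hX 1 (one_pow 2)
  obtain ⟨l, hl, hl2, hl3⟩ := hN X ev hX (-1) hs
  have hγ : 0 < 1 / ((N : ℝ) + 2) ^ 2 := by positivity
  have n1 := hX.endWeight_nonneg (one_pow 2)
  have n2 := hX.endWeight_nonneg hs
  have s1 := hX.sum_endWeight 1
  have s2 := hX.sum_endWeight (-1)
  rw [hU2.norm_sq.deriv, hU1, abs_mul, abs_two]
  refine mul_le_mul_of_nonneg_left ?_ zero_le_two
  refine (abs_inner_le_of_two_level (m := 1 - w⁻¹ ^ 2) ht (by nlinarith)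
    (by nlinarith) (norm_charSum_le n1 s1 t) (norm_charSum_le n2 s2 t)
    (Complex.norm_exp_ofReal_mul_I _) (Complex.norm_exp_ofReal_mul_I _)
    (norm_charSum_sub_le n1 s1 t k) (norm_charSum_sub_le n2 s2 t l)
    (norm_integral_charSum_mul_sub_le n1 s1 ht hγ k hk2 hk3 hε.le)
    (norm_integral_charSum_mul_sub_le n2 s2 ht hγ l hl2 hl3 hε.le) hk hl (n1 k) (n2 l)).trans
    (le_of_eq ?_)
  rw [div_div_eq_mul_div, div_one]
  ring

theorem mainTheorem8 (w : ℝ) (hw : 1 < w) :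
    ∃ f g : ℕ → ℝ,
      f =O[atTop] (fun n : ℕ => (n : ℝ) ^ 2) ∧
      g =O[atTop] (fun n : ℕ => 1 / (n : ℝ)) ∧
      ∀ (n : ℕ) (hn : 2 ≤ n) (t : ℝ), 0 ≤ t →
        DifferentiableAt ℝ (fun x : ℝ => endFidelity n (Nat.zero_lt_of_lt hn) x t) w ∧
        |deriv (fun x : ℝ => endFidelity n (Nat.zero_lt_of_lt hn) x t) w| ≤
          8 * (n : ℝ) ^ 3 / (3 * Real.pi ^ 2) + f n +
            4 * t * ((w ^ 4 - 2 * w ^ 2 + 3) / (2 * w ^ 6) + g n) := by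
  have hw0 : 0 < w := by linarith
  -- With this `ε` the error `10 * t * ε` is `2 * t / w ^ 6`, raising the numerator constant from
  -- `1` to `2`, still below `3`.
  obtain ⟨N₀, hN₀⟩ := eventually_atTop.1
    (eventually_abs_deriv_endFidelity_le hw (ε := 1 / (5 * w ^ 6)) (by positivity))
  -- `f` is the off-resonant error. `g` vanishes for long paths; for the finitely many short ones `g
  -- = 1` gives `4 * t`, above the crude `2 * t`. Only nonnegativity of the cubic term is needed.
  refine ⟨fun n => 4 * (n : ℝ) ^ 2, fun n => if n < N₀ + 2 then 1 else 0,
    (isBigO_refl _ _).const_mul_left 4, ?_, ?_⟩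
  · refine (isBigO_zero _ _).congr' ?_ EventuallyEq.rfl
    filter_upwards [eventually_ge_atTop (N₀ + 2)] with n hn
    rw [if_neg (by omega)]
  · intro n hn t ht
    obtain ⟨N, rfl⟩ : ∃ N, n = N + 2 := ⟨n - 2, by omega⟩
    obtain ⟨hd, hb⟩ := abs_deriv_endFidelity_le N (Nat.zero_lt_of_lt hn) w ht
    refine ⟨hd, ?_⟩
    have h1 : 0 ≤ 8 * ((N + 2 : ℕ) : ℝ) ^ 3 / (3 * Real.pi ^ 2) := by positivity
    have h2 : 0 ≤ 4 * ((N + 2 : ℕ) : ℝ) ^ 2 := by positivity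
    dsimp only
    by_cases hN : N + 2 < N₀ + 2
    · rw [if_pos hN]
      have h3 : 0 ≤ (w ^ 4 - 2 * w ^ 2 + 3) / (2 * w ^ 6) :=
        div_nonneg (by nlinarith [sq_nonneg (w ^ 2 - 1)]) (by positivity)
      nlinarith [mul_nonneg ht h3]
    · rw [if_neg hN, add_zero]
      refine (hN₀ N (by omega) (Nat.zero_lt_of_lt hn) t ht).trans ?_
      have e : 2 * (t * ((1 - w⁻¹ ^ 2) ^ 2 * w⁻¹ ^ 2) + 5 * t * (1 / (5 * w ^ 6)) +
          2 * ((N : ℝ) + 2) ^ 2) + 0 = 4 * ((N + 2 : ℕ) : ℝ) ^ 2 +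
          4 * t * ((w ^ 4 - 2 * w ^ 2 + 2) / (2 * w ^ 6)) := by
        push_cast
        field_simp
        ring
      have h4 : (w ^ 4 - 2 * w ^ 2 + 2) / (2 * w ^ 6) ≤ (w ^ 4 - 2 * w ^ 2 + 3) / (2 * w ^ 6) := by
        gcongr
        norm_num
      have h5 := mul_le_mul_of_nonneg_left h4 (by positivity : 0 ≤ 4 * t)
      linarith
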